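/- Let $K$ be a field with algebraic closure $\overline K$, let $n\ge 1$, and let $f\in K[X_1,\dots,X_n]$ be absolutely irreducible (irreducible in $\overline K[X_1,\dots,X_n]$) of total degree $\delta$. For $\nu=(\nu_1,\dots,\nu_n)\in\overline K^{\,n}$ and $\omega=(\omega_2,\dots,\omega_n)\in\overline K^{\,n-1}$ put $$\chi(X,Y,Z_2,\dots,Z_n):=f(X+\nu_1,\ \omega_2X+Z_2Y+\nu_2,\ \dots,\ \omega_nX+Z_nY+\nu_n)\in\overline K[X,Y,Z_2,\dots,Z_n].$$ Call $(\nu,\omega)$ generic if (i) the leading coefficient of $\chi$ with respect to $X$ is a nonzero element of $\overline K$; (ii) the discriminant of $\chi(X,0,Z_2,\dots,Z_n)$ with respect to $X$ is nonzero; (iii) $\chi$ is irreducible in $\overline K[X,Y,Z_2,\dots,Z_n]$. Then: (a) There is a nonzero polynomial $\Upsilon\in K[V_1,\dots,V_n,W_2,\dots,W_n]$ of degree at most $2\delta^2$ such that every $(\nu,\omega)\in\overline K^{\,2n-1}$ with $\Upsilon(\nu,\omega)\ne 0$ is generic. (b) Let $1\le D\le\delta-1$ and let $(\nu,\omega)$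 be generic (in particular, this covers every $(\nu,\omega)$ with $\Upsilon(\nu,\omega)\neq0$ for any $\Upsilon$ as in (a)). Then there is a nonzero polynomial $\Psi_D\in\overline K[Z_2,\dots,Z_n]$ of total degree $$\deg\Psi_D\le D\delta^2(D+1)(D+2)-\frac{(D^2+3D)(D^2+3D+2)\,\delta}{8}$$ such that for every $\eta=(\eta_2,\dots,\eta_n)\in\overline K^{\,n-1}$ with $\Psi_D(\eta)\ne0$ the polynomial $\chi(X,Y,\eta)=f(X+\nu_1,\omega_2X+\eta_2Y+\nu_2,\dots,\omega_nX+\eta_nY+\nu_n)$ has no irreducible factor of total degree at most $D$ in $\overline K[X,Y]$. -/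

import Mathlib

namespace KaltofenPlane

/-- `f (x + ν₁, ω₂ x + z₂ y + ν₂, …, ωₙ x + zₙ y + νₙ)`, evaluated in a commutative `L`-algebra `R`,
for a polynomial `f` in the `n = m + 1` variables `X₁, …, Xₙ`. The index `0 : Fin (m + 1)` stands
for the variable `X₁`, and `i : Fin m` (that is, `i.succ : Fin (m + 1)`) for `X_{i + 2}`. -/
noncomputable def planeSubst {K L : Type*} [Field K] [Field L] [Algebra K L] {m : ℕ}
    (f : MvPolynomial (Fin (m + 1)) K) (ν : Fin (m + 1) → L) (ω : Fin m → L)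
    (R : Type*) [CommRing R] [Algebra L R] (x y : R) (z : Fin m → R) : R :=
  MvPolynomial.eval₂ ((algebraMap L R).comp (algebraMap K L))
    (Fin.cons (x + algebraMap L R (ν 0))
      (fun i : Fin m =>
        algebraMap L R (ω i) * x + z i * y + algebraMap L R (ν i.succ))) f

/-- The generic plane section `χ(X, Y, Z₂, …, Zₙ)`, as an element of `L[Z₂, …, Zₙ][Y][X]`:
the outer polynomial variable is `X`, the inner one is `Y`. -/
noncomputable def chi {K L : Type*} [Field K] [Field L] [Algebra K L] {m : ℕ}
    (f : MvPolynomial (Fin (m + 1)) K) (ν : Fin (m + 1) → L) (ω : Fin m → L) :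
    Polynomial (Polynomial (MvPolynomial (Fin m) L)) :=
  planeSubst f ν ω (Polynomial (Polynomial (MvPolynomial (Fin m) L)))
    Polynomial.X (Polynomial.C Polynomial.X)
    (fun i => Polynomial.C (Polynomial.C (MvPolynomial.X i)))

/-- The polynomial `χ(X, 0, Z₂, …, Zₙ)`, as an element of `L[Z₂, …, Zₙ][X]`. -/
noncomputable def chiAtZero {K L : Type*} [Field K] [Field L] [Algebra K L] {m : ℕ}
    (f : MvPolynomial (Fin (m + 1)) K) (ν : Fin (m + 1) → L) (ω : Fin m → L) :
    Polynomial (MvPolynomial (Fin m) L) :=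
  (chi f ν ω).map (Polynomial.evalRingHom (0 : MvPolynomial (Fin m) L))

/-- The bivariate polynomial `χ(X, Y, η)` in `L[X, Y]`, with `X` and `Y` the variables of index
`0` and `1`. -/
noncomputable def chiAt {K L : Type*} [Field K] [Field L] [Algebra K L] {m : ℕ}
    (f : MvPolynomial (Fin (m + 1)) K) (ν : Fin (m + 1) → L) (ω η : Fin m → L) :
    MvPolynomial (Fin 2) L :=
  planeSubst f ν ω (MvPolynomial (Fin 2) L) (MvPolynomial.X 0) (MvPolynomial.X 1)
    (fun i => MvPolynomial.C (η i))

/-- The conditions on the parameters `(ν, ω)`: the leading coefficient of `χ` with respect to `X`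
is a nonzero constant, the discriminant of `χ(X, 0, Z₂, …, Zₙ)` with respect to `X` is nonzero,
and `χ` is irreducible in `L[X, Y, Z₂, …, Zₙ]`. -/
structure IsGenericPosition {K L : Type*} [Field K] [Field L] [Algebra K L] {m : ℕ}
    (f : MvPolynomial (Fin (m + 1)) K) (ν : Fin (m + 1) → L) (ω : Fin m → L) : Prop where
  leadingCoeff_const : ∃ c : L, c ≠ 0 ∧
    (chi f ν ω).leadingCoeff = Polynomial.C (MvPolynomial.C c)
  discr_ne_zero : (chiAtZero f ν ω).discr ≠ 0
  irreducible : Irreducible (chi f ν ω)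

end KaltofenPlane

/-! Part (b). Each `Z_i` enters `χ` only through `Z_i Y`, so `χ(X, 0, Z)` has coefficients in `L`,
and the discriminant condition makes its roots `α`, at most `δ` in number, simple. Newton iteration
lifts `α` to `a(Y)` with `χ(a, Y) ≡ 0` modulo `Y^(N+1)`, `N = 2Dδ`, where the coefficient of `Y^k`
in `a` is a polynomial of degree at most `k` in `Z` (`exists_approx_root`). An irreducible factor
`g` of `χ(X, Y, η)` of degree at most `D` vanishes at some `(α, 0)`, because the leading coefficient
in `X` is constant. As `α` is simple, the cofactor does not vanish there, so `g(a_η, Y) ≡ 0` modulo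
`Y^(N+1)`. This is a linear system in the `M = (D+1)(D+2)/2` coefficients of `g`, and its row `l`
has degree at most `l` in `Z`.

Over `L[Z]` the system has only the zero solution: for a solution `G`, the resultant of `χ` and `G`
in `X` has degree at most `δD + Dδ = N` in `Y`, yet is divisible by `Y^(N+1)`. So it vanishes, and
the irreducible `χ` divides `G` (`Polynomial.dvd_of_X_pow_dvd_eval`), which forces `G = 0` because
`χ` has degree at least `δ > D` in `X, Y`. Hence some maximal minor is nonzero; its degree is at
most a sum of `M` distinct row indices `≤ N`, that is, at most `NM - M(M-1)/2`. The product of these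
minors over the roots `α` is `Ψ_D`.

Part (a). Let `F = f(V + X(1, W))` and let `Υ` be its coefficient of `X^δ` times the resultant of
`F` and `F'`; its degree is at most `δ + δ² + (δ-1)δ = 2δ²`. A shift automorphism carries `f(V)` to
`F`, so `F` is prime (`prime_genericLine`). Also `F' ≠ 0`, since an irreducible polynomial over an
algebraically closed field is not a `p`-th power. Thus `F` and `F'` are coprime over the fraction
field and `Υ ≠ 0`. Irreducibility of `χ` costs no further degree: the plane substitution is
invertible once `Y` is inverted, and the constant leading coefficient excludes the factor `Y`
(`irreducible_chi`). -/

/-! ### Degrees of determinants and resultants. -/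

section DegreeBounds

/-- A determinant is bounded by the sum of the column bounds of its matrix, for any degree-like
function. -/
theorem Matrix.degree_det_le_of_col {R n : Type*} [CommRing R] [Fintype n] [DecidableEq n]
    (deg : R → ℕ) (deg_one : deg 1 = 0) (deg_neg : ∀ x, deg (-x) = deg x)
    (deg_add : ∀ x y, deg (x + y) ≤ max (deg x) (deg y))
    (deg_mul : ∀ x y, deg (x * y) ≤ deg x + deg y)
    (A : Matrix n n R) (d : n → ℕ) (hA : ∀ i j, deg (A i j) ≤ d j) :
    deg A.det ≤ ∑ j, d j := by
  have deg_zero : deg 0 = 0 := by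
    have := deg_mul 0 1
    by_contra h
    have h1 := deg_add 1 (-1)
    rw [deg_neg, deg_one, add_neg_cancel] at h1
    omega
  have deg_prod : ∀ (s : Finset n) (f : n → R), deg (∏ i ∈ s, f i) ≤ ∑ i ∈ s, deg (f i) := by
    classical
    intro s f
    induction s using Finset.induction_on with
    | empty => simp [deg_one]
    | insert a s ha ih =>
      rw [Finset.prod_insert ha, Finset.sum_insert ha]
      exact (deg_mul _ _).trans (by omega)
  have deg_sum : ∀ (s : Finset (Equiv.Perm n)) (f : Equiv.Perm n → R) (b : ℕ),
      (∀ i ∈ s, deg (f i) ≤ b) → deg (∑ i ∈ s, f i) ≤ b := by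
    intro s f b
    induction s using Finset.induction_on with
    | empty => simp [deg_zero]
    | insert a s ha ih =>
      intro h
      rw [Finset.sum_insert ha]
      exact (deg_add _ _).trans (max_le (h a (Finset.mem_insert_self _ _))
        (ih fun i hi => h i (Finset.mem_insert_of_mem hi)))
  rw [Matrix.det_apply]
  refine deg_sum _ _ _ fun σ _ => ?_
  have hs : deg (Equiv.Perm.sign σ • ∏ i, A (σ i) i) = deg (∏ i, A (σ i) i) := by
    rcases Int.units_eq_one_or (Equiv.Perm.sign σ) with h | h <;> simp [h, deg_neg]
  rw [hs]
  exact (deg_prod _ _).trans (Finset.sum_le_sum fun i _ => hA _ _)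

theorem MvPolynomial.totalDegree_det_le {R σ n : Type*} [CommRing R] [Fintype n] [DecidableEq n]
    (A : Matrix n n (MvPolynomial σ R)) (d : n → ℕ) (hA : ∀ i j, (A i j).totalDegree ≤ d j) :
    A.det.totalDegree ≤ ∑ j, d j :=
  Matrix.degree_det_le_of_col MvPolynomial.totalDegree MvPolynomial.totalDegree_one
    MvPolynomial.totalDegree_neg MvPolynomial.totalDegree_add MvPolynomial.totalDegree_mul A d hA

theorem Polynomial.natDegree_det_le {R n : Type*} [CommRing R] [Fintype n] [DecidableEq n]
    (A : Matrix n n (Polynomial R)) (d : n → ℕ) (hA : ∀ i j, (A i j).natDegree ≤ d j) :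
    A.det.natDegree ≤ ∑ j, d j :=
  Matrix.degree_det_le_of_col (fun p => p.natDegree) Polynomial.natDegree_one
    (fun p => Polynomial.natDegree_neg p) (fun p q => Polynomial.natDegree_add_le p q)
    (fun p q => Polynomial.natDegree_mul_le (p := p) (q := q)) A d hA

/-- In the Sylvester matrix `m` columns hold coefficients of `g` and `n` columns hold coefficients
of `f`. -/
theorem Polynomial.natDegree_resultant_le {R : Type*} [CommRing R]
    (f g : Polynomial (Polynomial R)) (m n a b : ℕ) (hf : ∀ k, (f.coeff k).natDegree ≤ a)
    (hg : ∀ k, (g.coeff k).natDegree ≤ b) :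
    (Polynomial.resultant f g m n).natDegree ≤ m * b + n * a := by
  refine (Polynomial.natDegree_det_le _ (Fin.addCases (fun _ => b) (fun _ => a)) ?_).trans ?_
  · intro i j
    refine Fin.addCases (fun j => ?_) (fun j => ?_) j
    · simp only [Polynomial.sylvester, Matrix.of_apply, Fin.addCases_left]
      split_ifs
      · exact hg _
      · simp
    · simp only [Polynomial.sylvester, Matrix.of_apply, Fin.addCases_right]
      split_ifs
      · exact hf _
      · simp
  · simp [Fin.sum_univ_add]

theorem MvPolynomial.totalDegree_resultant_le {R σ : Type*} [CommRing R]
    (f g : Polynomial (MvPolynomial σ R)) (m n a b : ℕ) (hf : ∀ k, (f.coeff k).totalDegree ≤ a)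
    (hg : ∀ k, (g.coeff k).totalDegree ≤ b) :
    (Polynomial.resultant f g m n).totalDegree ≤ m * b + n * a := by
  refine (MvPolynomial.totalDegree_det_le _ (Fin.addCases (fun _ => b) (fun _ => a)) ?_).trans ?_
  · intro i j
    refine Fin.addCases (fun j => ?_) (fun j => ?_) j
    · simp only [Polynomial.sylvester, Matrix.of_apply, Fin.addCases_left]
      split_ifs
      · exact hg _
      · simp
    · simp only [Polynomial.sylvester, Matrix.of_apply, Fin.addCases_right]
      split_ifs
      · exact hf _
      · simp
  · simp [Fin.sum_univ_add]

end DegreeBounds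

/-! ### Sums of distinct indices, and maximal minors. -/

section Combinatorics

theorem Finset.sum_range_card_le_sum (s : Finset ℕ) : ∑ i ∈ Finset.range s.card, i ≤ ∑ i ∈ s, i := by
  induction s using Finset.induction_on_max with
  | empty => simp
  | insert a s ha ih =>
    have hn : a ∉ s := fun h => (ha a h).false
    have hc : s.card ≤ a := by
      have : s ⊆ Finset.range a := fun x hx => Finset.mem_range.2 (ha x hx)
      simpa using Finset.card_le_card this
    rw [Finset.card_insert_of_notMem hn, Finset.sum_range_succ, Finset.sum_insert hn]
    omega

/-- The complements `N - e i` are distinct naturals, so their sum is at least `0 + 1 + ⋯ + (M - 1)`.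
This produces the negative term of the final degree bound; the factor `2` avoids division in `ℕ`. -/
theorem two_mul_sum_fin_add_le {ι : Type*} [Fintype ι] {N : ℕ} (e : ι → Fin (N + 1))
    (he : Function.Injective e) :
    2 * ∑ i, (e i : ℕ) + Fintype.card ι * (Fintype.card ι - 1) ≤ 2 * (N * Fintype.card ι) := by
  classical
  have hinj : Function.Injective fun i => N - (e i : ℕ) := by
    intro i j hij
    apply he
    have := (e i).is_lt
    have := (e j).is_lt
    simp only at hij
    ext
    omega
  have h1 := Finset.sum_range_card_le_sum (Finset.univ.image fun i => N - (e i : ℕ))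
  rw [Finset.card_image_of_injective _ hinj, Finset.sum_image hinj.injOn, Finset.card_univ] at h1
  have h2 := Finset.sum_range_id_mul_two (Fintype.card ι)
  have h3 : ∑ i, (e i : ℕ) + ∑ i, (N - (e i : ℕ)) = N * Fintype.card ι := by
    rw [← Finset.sum_add_distrib, Finset.sum_congr rfl (g := fun _ => N)]
    · simp [mul_comm]
    · intro i _
      have := (e i).is_lt
      omega
  omega

/-- A matrix over a domain with trivial kernel has a nonzero maximal minor. -/
theorem Matrix.exists_submatrix_det_ne_zero {R m n : Type*} [CommRing R] [IsDomain R]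
    [Fintype m] [Fintype n] [DecidableEq n] (A : Matrix m n R)
    (hA : ∀ v, A.mulVec v = 0 → v = 0) :
    ∃ e : n → m, Function.Injective e ∧ (A.submatrix e id).det ≠ 0 := by
  classical
  let K := FractionRing R
  let B : Matrix m n K := A.map (algebraMap R K)
  have hB : LinearIndependent K B.col := by
    rw [← LinearIndependent.iff_fractionRing R K, Fintype.linearIndependent_iff]
    intro g hg
    refine congrFun (hA g ?_)
    ext i
    have := congrFun hg i
    apply IsFractionRing.injective R K
    simpa [Matrix.mulVec, dotProduct, B, Algebra.smul_def, mul_comm, Matrix.col_apply] using this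
  have hrank : Module.finrank K (Submodule.span K (Set.range B.row)) = Fintype.card n := by
    rw [← Matrix.rank_eq_finrank_span_row, Matrix.rank_eq_finrank_span_cols]
    exact (linearIndependent_iff_card_eq_finrank_span.mp hB).symm
  -- A maximal independent family of rows has exactly as many members as there are columns, because
  -- row rank equals column rank.
  obtain ⟨κ, a, ha, hspan, hli⟩ := exists_linearIndependent' K B.row
  have : Finite κ := Finite.of_injective a ha
  have := Fintype.ofFinite κ
  have hcard : Fintype.card κ = Fintype.card n := by
    rw [← hrank, ← hspan]
    exact linearIndependent_iff_card_eq_finrank_span.mp hli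
  let u : n ≃ κ := (Fintype.equivOfCardEq hcard).symm
  refine ⟨a ∘ u, ha.comp u.injective, fun h => ?_⟩
  have h1 : LinearIndependent K (B.submatrix (a ∘ u) id).row := by
    exact hli.comp u u.injective
  rw [Matrix.linearIndependent_rows_iff_isUnit, Matrix.isUnit_iff_isUnit_det] at h1
  have h2 : (B.submatrix (a ∘ u) id).det = algebraMap R K (A.submatrix (a ∘ u) id).det := by
    rw [RingHom.map_det]; rfl
  rw [h2, h, map_zero] at h1
  exact not_isUnit_zero h1

end Combinatorics

/-! ### Degree filtrations and top homogeneous parts. -/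

section Filtration

/-- If `P 0 ≤ P 1 ≤ ⋯` behaves like an exhaustive filtration and the points `x i` have level one,
then the value of a polynomial of total degree `d` at `x` has level `d`. -/
theorem MvPolynomial.aeval_filtration {K S σ : Type*} [CommRing K] [CommRing S] [Algebra K S]
    (P : ℕ → S → Prop) (mono : ∀ d e x, d ≤ e → P d x → P e x)
    (algebraMap_mem : ∀ r, P 0 (algebraMap K S r))
    (add_mem : ∀ d x y, P d x → P d y → P d (x + y))
    (mul_mem : ∀ d e x y, P d x → P e y → P (d + e) (x * y))
    (x : σ → S) (hx : ∀ i, P 1 (x i)) (f : MvPolynomial σ K) (d : ℕ) (hd : f.totalDegree ≤ d) :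
    P d (MvPolynomial.aeval x f) := by
  classical
  have one_mem : P 0 1 := by simpa using algebraMap_mem 1
  have zero_mem : ∀ d, P d 0 := fun d => mono 0 d _ d.zero_le (by simpa using algebraMap_mem 0)
  have pow_mem : ∀ i n, P n (x i ^ n) := by
    intro i n
    induction n with
    | zero => simpa using one_mem
    | succ n ih => rw [pow_succ]; exact mul_mem _ _ _ _ ih (hx i)
  have prod_mem : ∀ (s : Finset σ) (u : σ → ℕ), P (∑ i ∈ s, u i) (∏ i ∈ s, x i ^ u i) := by
    intro s u
    induction s using Finset.induction_on with
    | empty => simpa using one_mem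
    | insert a s ha ih =>
      rw [Finset.prod_insert ha, Finset.sum_insert ha]
      exact mul_mem _ _ _ _ (pow_mem _ _) ih
  rw [MvPolynomial.aeval_def, MvPolynomial.eval₂_eq]
  have key : ∀ s ⊆ f.support,
      P d (∑ t ∈ s, algebraMap K S (f.coeff t) * ∏ i ∈ t.support, x i ^ t i) := by
    intro s
    induction s using Finset.induction_on with
    | empty => intro _; simpa using zero_mem d
    | insert a s ha ih =>
      intro hs
      rw [Finset.sum_insert ha]
      refine add_mem _ _ _ ?_ (ih fun i hi => hs (Finset.mem_insert_of_mem hi))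
      refine mono (0 + ∑ i ∈ a.support, a i) _ _ ?_
        (mul_mem _ _ _ _ (algebraMap_mem _) (prod_mem _ _))
      rw [zero_add]
      exact (MvPolynomial.le_totalDegree (hs (Finset.mem_insert_self _ _))).trans hd
  exact key _ subset_rfl

theorem Polynomial.natDegree_aeval_le {K R σ : Type*} [CommRing K] [CommRing R] [Algebra K R]
    (x : σ → Polynomial R) (hx : ∀ i, (x i).natDegree ≤ 1) (f : MvPolynomial σ K) :
    (MvPolynomial.aeval x f).natDegree ≤ f.totalDegree :=
  MvPolynomial.aeval_filtration (fun d p => p.natDegree ≤ d) (fun _ _ _ h h' => h'.trans h)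
    (fun r => by simp [Polynomial.algebraMap_apply])
    (fun _ _ _ h h' => Polynomial.natDegree_add_le_of_degree_le h h')
    (fun _ _ _ _ h h' => Polynomial.natDegree_mul_le_of_le h h') x hx f _ le_rfl

/-- The slope `c` serves two uses: `c = 0` for bounds uniform in `k`, and `c = 1` for the diagonal
bound, where the coefficient of `Y ^ k` has degree at most `k`. -/
theorem Polynomial.coeff_filtration_mul {R : Type*} [CommRing R] (deg : R → ℕ)
    (deg_zero : deg 0 = 0) (deg_add : ∀ x y, deg (x + y) ≤ max (deg x) (deg y))
    (deg_mul : ∀ x y, deg (x * y) ≤ deg x + deg y) (c d e : ℕ) (p q : Polynomial R)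
    (hp : ∀ k, deg (p.coeff k) ≤ c * k + d) (hq : ∀ k, deg (q.coeff k) ≤ c * k + e) (k : ℕ) :
    deg ((p * q).coeff k) ≤ c * k + (d + e) := by
  rw [Polynomial.coeff_mul]
  have key : ∀ s ⊆ Finset.HasAntidiagonal.antidiagonal k,
      deg (∑ x ∈ s, p.coeff x.1 * q.coeff x.2) ≤ c * k + (d + e) := by
    intro s
    induction s using Finset.induction_on with
    | empty => simp [deg_zero]
    | insert a s ha ih =>
      intro hs
      rw [Finset.sum_insert ha]
      refine (deg_add _ _).trans (max_le ?_ (ih fun i hi => hs (Finset.mem_insert_of_mem hi)))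
      have := Finset.HasAntidiagonal.mem_antidiagonal.1 (hs (Finset.mem_insert_self _ _))
      refine (deg_mul _ _).trans ((add_le_add (hp _) (hq _)).trans (le_of_eq ?_))
      rw [← this]
      ring
  exact key _ subset_rfl

theorem MvPolynomial.totalDegree_coeff_aeval_le {K σ τ : Type*} [CommRing K]
    (x : σ → Polynomial (MvPolynomial τ K)) (hx : ∀ i k, ((x i).coeff k).totalDegree ≤ 1)
    (f : MvPolynomial σ K) (k : ℕ) :
    ((MvPolynomial.aeval x f).coeff k).totalDegree ≤ f.totalDegree := by
  refine MvPolynomial.aeval_filtration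
    (fun d (p : Polynomial (MvPolynomial τ K)) => ∀ k, (p.coeff k).totalDegree ≤ d)
    ?_ ?_ ?_ ?_ x hx f _ le_rfl k
  · exact fun _ _ _ h h' k => (h' k).trans h
  · intro r k
    rw [Polynomial.algebraMap_apply, Polynomial.coeff_C]
    split_ifs <;> simp [MvPolynomial.algebraMap_eq]
  · intro d p q h h' k
    rw [Polynomial.coeff_add]
    exact (MvPolynomial.totalDegree_add _ _).trans (max_le (h k) (h' k))
  · intro d e p q hp hq k
    have := Polynomial.coeff_filtration_mul (fun u : MvPolynomial τ K => u.totalDegree)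
      MvPolynomial.totalDegree_zero (fun u v => MvPolynomial.totalDegree_add u v)
      (fun u v => MvPolynomial.totalDegree_mul u v)
      0 d e p q (fun k => by rw [zero_mul, zero_add]; exact hp k)
      (fun k => by rw [zero_mul, zero_add]; exact hq k) k
    rwa [zero_mul, zero_add] at this

theorem Polynomial.natDegree_coeff_aeval_le {K R σ : Type*} [CommRing K] [CommRing R] [Algebra K R]
    (x : σ → Polynomial (Polynomial R)) (hx : ∀ i k, ((x i).coeff k).natDegree ≤ 1)
    (f : MvPolynomial σ K) (k : ℕ) :
    ((MvPolynomial.aeval x f).coeff k).natDegree ≤ f.totalDegree := by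
  refine MvPolynomial.aeval_filtration
    (fun d (p : Polynomial (Polynomial R)) => ∀ k, (p.coeff k).natDegree ≤ d)
    ?_ ?_ ?_ ?_ x hx f _ le_rfl k
  · exact fun _ _ _ h h' k => (h' k).trans h
  · intro r k
    rw [Polynomial.algebraMap_apply, Polynomial.coeff_C]
    split_ifs <;> simp [Polynomial.algebraMap_apply]
  · intro d p q h h' k
    rw [Polynomial.coeff_add]
    exact (Polynomial.natDegree_add_le _ _).trans (max_le (h k) (h' k))
  · intro d e p q hp hq k
    have := Polynomial.coeff_filtration_mul (fun u : Polynomial R => u.natDegree)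
      Polynomial.natDegree_zero (fun u v => Polynomial.natDegree_add_le u v)
      (fun u v => Polynomial.natDegree_mul_le (p := u) (q := v))
      0 d e p q (fun k => by rw [zero_mul, zero_add]; exact hp k)
      (fun k => by rw [zero_mul, zero_add]; exact hq k) k
    rwa [zero_mul, zero_add] at this

/-- Along the line `b + c T`, the coefficient of `T ^ d` of a polynomial of total degree at most `d`
is the value at `c` of its homogeneous part of degree `d`. -/
theorem MvPolynomial.coeff_aeval_line {K R σ : Type*} [CommRing K] [CommRing R] [Algebra K R]
    (b c : σ → R) (f : MvPolynomial σ K) (d : ℕ) (hd : f.totalDegree ≤ d) :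
    (MvPolynomial.aeval (fun i => Polynomial.C (b i) + Polynomial.C (c i) * Polynomial.X) f).coeff d
      = MvPolynomial.aeval c (MvPolynomial.homogeneousComponent d f) := by
  classical
  have hX : ∀ i, (Polynomial.C (b i) + Polynomial.C (c i) * Polynomial.X).natDegree ≤ 1 := by
    intro i
    rw [add_comm]
    exact Polynomial.natDegree_linear_le
  have hmon : ∀ t : σ →₀ ℕ,
      (∏ i ∈ t.support, (Polynomial.C (b i) + Polynomial.C (c i) * Polynomial.X) ^ t i).natDegree
        ≤ t.degree ∧
      (∏ i ∈ t.support, (Polynomial.C (b i) + Polynomial.C (c i) * Polynomial.X) ^ t i).coeff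
        t.degree = ∏ i ∈ t.support, c i ^ t i := by
    intro t
    rw [Finsupp.degree_apply]
    generalize t.support = s
    induction s using Finset.induction_on with
    | empty => simp
    | insert a s ha ih =>
      rw [Finset.prod_insert ha, Finset.sum_insert ha, Finset.prod_insert ha]
      have h1 : ((Polynomial.C (b a) + Polynomial.C (c a) * Polynomial.X) ^ t a).natDegree
          ≤ t a := by
        simpa using Polynomial.natDegree_pow_le_of_le (t a) (hX a)
      refine ⟨Polynomial.natDegree_mul_le_of_le h1 ih.1, ?_⟩
      rw [Polynomial.coeff_mul_add_eq_of_natDegree_le h1 ih.1, ih.2]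
      congr 1
      simpa using Polynomial.coeff_pow_of_natDegree_le (hX a) (m := t a)
  rw [MvPolynomial.aeval_def, MvPolynomial.eval₂_eq, Polynomial.finsetSum_coeff,
    MvPolynomial.homogeneousComponent_apply, map_sum, Finset.sum_filter]
  refine Finset.sum_congr rfl fun t ht => ?_
  have htd : t.degree ≤ d := by
    refine le_trans ?_ hd
    rw [Finsupp.degree_apply]
    exact MvPolynomial.le_totalDegree ht
  rw [Polynomial.algebraMap_apply, Polynomial.coeff_C_mul]
  split_ifs with h
  · rw [← h, (hmon t).2, MvPolynomial.aeval_monomial, Finsupp.prod]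
  · rw [Polynomial.coeff_eq_zero_of_natDegree_lt, mul_zero]
    exact (hmon t).1.trans_lt (lt_of_le_of_ne htd h)

theorem MvPolynomial.homogeneousComponent_totalDegree_ne_zero {K σ : Type*} [CommRing K]
    (f : MvPolynomial σ K) (hf : f ≠ 0) :
    MvPolynomial.homogeneousComponent f.totalDegree f ≠ 0 := by
  classical
  obtain ⟨t, ht, htd⟩ := Finset.exists_mem_eq_sup f.support
    (MvPolynomial.support_nonempty.2 hf) (fun s => s.sum fun _ e => e)
  intro h
  have := congrArg (MvPolynomial.coeff t) h
  rw [MvPolynomial.coeff_homogeneousComponent, if_pos, MvPolynomial.coeff_zero] at this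
  · exact MvPolynomial.mem_support_iff.1 ht this
  · rw [Finsupp.degree_apply]
    exact htd.symm

end Filtration

/-! ### Bivariate polynomials of bounded degree and the linear system for a factor. -/

section BivariateIndex

/-- Indices for the monomials `x ^ k * y ^ (n - k)` of degree `n ≤ D` in two variables. -/
abbrev BivariateIndex (D : ℕ) : Type := Σ n : Fin (D + 1), Fin ((n : ℕ) + 1)

theorem card_bivariateIndex (D : ℕ) :
    2 * Fintype.card (BivariateIndex D) = (D + 1) * (D + 2) := by
  rw [Fintype.card_sigma]
  simp only [Fintype.card_fin]
  rw [Fin.sum_univ_eq_sum_range (fun n => n + 1) (D + 1)]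
  induction D with
  | zero => simp
  | succ D ih => rw [Finset.sum_range_succ, mul_add, ih]; ring

/-- The exponent vector of a monomial index. -/
noncomputable def BivariateIndex.exponent {D : ℕ} (i : BivariateIndex D) : Fin 2 →₀ ℕ :=
  Finsupp.single 0 (i.2 : ℕ) + Finsupp.single 1 ((i.1 : ℕ) - i.2)

theorem BivariateIndex.exponent_zero {D : ℕ} (i : BivariateIndex D) : i.exponent 0 = i.2 := by
  simp [exponent]

theorem BivariateIndex.exponent_one {D : ℕ} (i : BivariateIndex D) : i.exponent 1 = i.1 - i.2 := by
  simp [exponent]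

theorem BivariateIndex.exponent_injective (D : ℕ) :
    Function.Injective (BivariateIndex.exponent (D := D)) := by
  rintro ⟨n, k⟩ ⟨n', k'⟩ h
  have h0 := DFunLike.congr_fun h 0
  have h1 := DFunLike.congr_fun h 1
  simp only [exponent_zero, exponent_one] at h0 h1
  have hk := k.is_lt
  have hk' := k'.is_lt
  obtain rfl : n = n' := by ext; omega
  obtain rfl : k = k' := by ext; omega
  rfl

theorem BivariateIndex.exists_exponent_eq {D : ℕ} (s : Fin 2 →₀ ℕ) (hs : s 0 + s 1 ≤ D) :
    ∃ i : BivariateIndex D, i.exponent = s := by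
  refine ⟨⟨⟨s 0 + s 1, by omega⟩, ⟨s 0, by simp only; omega⟩⟩, ?_⟩
  ext j
  fin_cases j
  · exact exponent_zero _
  · simpa using exponent_one (D := D) ⟨⟨s 0 + s 1, by omega⟩, ⟨s 0, by simp only; omega⟩⟩

variable {R : Type*} [CommRing R] {D : ℕ}

theorem MvPolynomial.eq_sum_bivariateIndex (g : MvPolynomial (Fin 2) R) (hg : g.totalDegree ≤ D) :
    g = ∑ i : BivariateIndex D, MvPolynomial.monomial i.exponent (g.coeff i.exponent) := by
  classical
  ext s
  rw [MvPolynomial.coeff_sum]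
  simp only [MvPolynomial.coeff_monomial]
  by_cases hs : s 0 + s 1 ≤ D
  · obtain ⟨i, rfl⟩ := BivariateIndex.exists_exponent_eq s hs
    rw [Finset.sum_eq_single i]
    · simp
    · intro j _ hj
      rw [if_neg]
      exact fun h => hj (BivariateIndex.exponent_injective D h)
    · simp
  · rw [Finset.sum_eq_zero]
    · rw [MvPolynomial.coeff_eq_zero_of_totalDegree_lt]
      refine hg.trans_lt (lt_of_lt_of_le (not_le.1 hs) ?_)
      rw [← Finsupp.degree_apply, Finsupp.degree_eq_sum, Fin.sum_univ_two]
    · intro i _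
      rw [if_neg]
      rintro rfl
      apply hs
      rw [BivariateIndex.exponent_zero, BivariateIndex.exponent_one]
      have := i.2.is_lt
      have := i.1.is_lt
      omega

theorem MvPolynomial.coeff_sum_bivariateIndex (v : BivariateIndex D → R) (i : BivariateIndex D) :
    (∑ j : BivariateIndex D, MvPolynomial.monomial j.exponent (v j)).coeff i.exponent = v i := by
  classical
  rw [MvPolynomial.coeff_sum]
  simp only [MvPolynomial.coeff_monomial, (BivariateIndex.exponent_injective D).eq_iff]
  simp

theorem MvPolynomial.totalDegree_sum_bivariateIndex_le (v : BivariateIndex D → R) :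
    (∑ j : BivariateIndex D, MvPolynomial.monomial j.exponent (v j)).totalDegree ≤ D := by
  refine MvPolynomial.totalDegree_finsetSum_le fun i _ => ?_
  refine (MvPolynomial.totalDegree_monomial_le _ _).trans ?_
  rw [Finsupp.sum_fintype _ _ (fun _ => rfl), Fin.sum_univ_two,
    BivariateIndex.exponent_zero, BivariateIndex.exponent_one, id, id]
  have := i.2.is_lt
  have := i.1.is_lt
  omega

/-- Row `l` collects the coefficients of `Y ^ l` in the products `a(Y) ^ k * Y ^ (n - k)`. -/
noncomputable def truncatedValueMatrix (D N : ℕ) (a : Polynomial R) :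
    Matrix (Fin (N + 1)) (BivariateIndex D) R :=
  fun l i => (a ^ (i.2 : ℕ) * Polynomial.X ^ ((i.1 : ℕ) - i.2)).coeff l

/-- Vanishing of `g(a(Y), Y)` modulo `Y ^ (N + 1)` is linear in the coefficients of `g`, with one
equation for each power of `Y`. -/
theorem X_pow_dvd_aeval_iff_mulVec (N : ℕ) (a : Polynomial R) (v : BivariateIndex D → R) :
    Polynomial.X ^ (N + 1) ∣ MvPolynomial.aeval ![a, Polynomial.X]
      (∑ j : BivariateIndex D, MvPolynomial.monomial j.exponent (v j)) ↔
    (truncatedValueMatrix D N a).mulVec v = 0 := by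
  have key : ∀ l : ℕ, (MvPolynomial.aeval ![a, Polynomial.X]
      (∑ j : BivariateIndex D, MvPolynomial.monomial j.exponent (v j))).coeff l =
      ∑ i : BivariateIndex D,
        (a ^ (i.2 : ℕ) * Polynomial.X ^ ((i.1 : ℕ) - i.2)).coeff l * v i := by
    intro l
    rw [map_sum, Polynomial.finsetSum_coeff]
    refine Finset.sum_congr rfl fun i _ => ?_
    rw [MvPolynomial.aeval_monomial, Polynomial.algebraMap_apply, Polynomial.coeff_C_mul,
      Algebra.algebraMap_self, RingHom.id_apply, mul_comm,
      Finsupp.prod_fintype _ _ (fun _ => pow_zero _), Fin.prod_univ_two,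
      BivariateIndex.exponent_zero, BivariateIndex.exponent_one]
    rfl
  rw [Polynomial.X_pow_dvd_iff]
  constructor
  · intro h
    ext l
    rw [Matrix.mulVec, dotProduct]
    exact (key l).symm.trans (h l l.is_lt)
  · intro h l hl
    rw [key]
    exact congrFun h ⟨l, hl⟩

theorem truncatedValueMatrix_map {S : Type*} [CommRing S] (φ : R →+* S) (N : ℕ)
    (a : Polynomial R) :
    (truncatedValueMatrix D N a).map φ = truncatedValueMatrix D N (a.map φ) := by
  ext l i
  simp only [truncatedValueMatrix, Matrix.map_apply]
  rw [← Polynomial.coeff_map]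
  simp

end BivariateIndex

/-! ### The diagonal degree bound and the minors of the system. -/

section DiagonalFiltration

variable {L σ : Type*} [CommRing L]

theorem MvPolynomial.totalDegree_coeff_mul_le (p q : Polynomial (MvPolynomial σ L))
    (hp : ∀ k, (p.coeff k).totalDegree ≤ k) (hq : ∀ k, (q.coeff k).totalDegree ≤ k) (k : ℕ) :
    ((p * q).coeff k).totalDegree ≤ k := by
  have := Polynomial.coeff_filtration_mul (fun u : MvPolynomial σ L => u.totalDegree)
    MvPolynomial.totalDegree_zero (fun u v => MvPolynomial.totalDegree_add u v)
    (fun u v => MvPolynomial.totalDegree_mul u v)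
    1 0 0 p q (fun k => by rw [one_mul, add_zero]; exact hp k)
    (fun k => by rw [one_mul, add_zero]; exact hq k) k
  rwa [one_mul, add_zero, add_zero] at this

theorem MvPolynomial.totalDegree_coeff_C_C_le (r : L) (k : ℕ) :
    ((Polynomial.C (MvPolynomial.C r : MvPolynomial σ L)).coeff k).totalDegree ≤ k := by
  rw [Polynomial.coeff_C]
  split_ifs <;> simp

/-- The diagonal bound defines a subalgebra, so the filtration argument applies with a level
condition that ignores the level. -/
theorem MvPolynomial.totalDegree_coeff_aeval_le_self {τ : Type*}
    (x : τ → Polynomial (MvPolynomial σ L)) (hx : ∀ i k, ((x i).coeff k).totalDegree ≤ k)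
    (f : MvPolynomial τ L) (k : ℕ) :
    ((MvPolynomial.aeval x f).coeff k).totalDegree ≤ k := by
  refine MvPolynomial.aeval_filtration
    (fun _ (p : Polynomial (MvPolynomial σ L)) => ∀ k, (p.coeff k).totalDegree ≤ k)
    ?_ ?_ ?_ ?_ x hx f _ le_rfl k
  · exact fun _ _ _ _ h => h
  · exact fun r k => MvPolynomial.totalDegree_coeff_C_C_le r k
  · intro d p q h h' k
    rw [Polynomial.coeff_add]
    exact (MvPolynomial.totalDegree_add _ _).trans (max_le (h k) (h' k))
  · exact fun _ _ p q hp hq => MvPolynomial.totalDegree_coeff_mul_le p q hp hq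

theorem totalDegree_truncatedValueMatrix_le (D N : ℕ) (a : Polynomial (MvPolynomial σ L))
    (ha : ∀ k, (a.coeff k).totalDegree ≤ k) (l : Fin (N + 1)) (i : BivariateIndex D) :
    (truncatedValueMatrix D N a l i).totalDegree ≤ l := by
  have := MvPolynomial.totalDegree_coeff_aeval_le_self ![a, Polynomial.X] (by
    intro j k
    fin_cases j
    · exact ha k
    · simp only [Fin.mk_one, Matrix.cons_val_one, Matrix.cons_val_fin_one, Polynomial.coeff_X]
      split_ifs <;> simp)
    (MvPolynomial.X 0 ^ (i.2 : ℕ) * MvPolynomial.X 1 ^ ((i.1 : ℕ) - i.2)) l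
  simpa [truncatedValueMatrix] using this

/-- A maximal minor of a truncated value matrix with trivial kernel, with its degree bound. -/
theorem exists_minor_of_truncatedValueMatrix {L : Type*} [Field L] (D N : ℕ)
    (a : Polynomial (MvPolynomial σ L)) (ha : ∀ k, (a.coeff k).totalDegree ≤ k)
    (hker : ∀ G : MvPolynomial (Fin 2) (MvPolynomial σ L), G.totalDegree ≤ D →
      Polynomial.X ^ (N + 1) ∣ MvPolynomial.aeval ![a, Polynomial.X] G → G = 0) :
    ∃ Ψ : MvPolynomial σ L, Ψ ≠ 0 ∧
      2 * Ψ.totalDegree + Fintype.card (BivariateIndex D) * (Fintype.card (BivariateIndex D) - 1)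
        ≤ 2 * (N * Fintype.card (BivariateIndex D)) ∧
      ∀ η : σ → L, MvPolynomial.eval η Ψ ≠ 0 → ∀ g : MvPolynomial (Fin 2) L, g.totalDegree ≤ D →
        Polynomial.X ^ (N + 1) ∣
          MvPolynomial.aeval ![a.map (MvPolynomial.eval η), Polynomial.X] g → g = 0 := by
  obtain ⟨e, he, hdet⟩ := (truncatedValueMatrix D N a).exists_submatrix_det_ne_zero (by
    intro v hv
    have h0 := hker _ (MvPolynomial.totalDegree_sum_bivariateIndex_le v)
      ((X_pow_dvd_aeval_iff_mulVec N a v).2 hv)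
    ext1 i
    rw [← MvPolynomial.coeff_sum_bivariateIndex v i, h0]
    simp)
  refine ⟨_, hdet, ?_, ?_⟩
  · refine le_trans ?_ (two_mul_sum_fin_add_le e he)
    gcongr
    -- The entries are bounded row by row, while the determinant bound is stated by columns.
    rw [← Matrix.det_transpose]
    exact MvPolynomial.totalDegree_det_le _ _ fun i j =>
      totalDegree_truncatedValueMatrix_le D N a ha _ _
  · intro η hη g hg hdvd
    rw [RingHom.map_det] at hη
    have hmap : (MvPolynomial.eval η).mapMatrix ((truncatedValueMatrix D N a).submatrix e id) =
        (truncatedValueMatrix D N (a.map (MvPolynomial.eval η))).submatrix e id := by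
      rw [← truncatedValueMatrix_map]
      rfl
    rw [hmap] at hη
    rw [MvPolynomial.eq_sum_bivariateIndex g hg, X_pow_dvd_aeval_iff_mulVec] at hdvd
    have hv : (fun i : BivariateIndex D => g.coeff i.exponent) = 0 := by
      refine Matrix.eq_zero_of_mulVec_eq_zero hη ?_
      ext j
      exact congrFun hdvd (e j)
    rw [MvPolynomial.eq_sum_bivariateIndex g hg]
    refine Finset.sum_eq_zero fun i _ => ?_
    have := congrFun hv i
    simp only [Pi.zero_apply] at this
    rw [this, map_zero]

end DiagonalFiltration

/-! ### The plane substitution and Newton iteration. -/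

namespace KaltofenPlane

section Substitution

variable {K L : Type*} [Field K] [Field L] [Algebra K L] {m : ℕ}
  (f : MvPolynomial (Fin (m + 1)) K) (ν : Fin (m + 1) → L) (ω : Fin m → L)

theorem planeSubst_eq_aeval (R : Type*) [CommRing R] [Algebra L R] (x y : R) (z : Fin m → R) :
    planeSubst f ν ω R x y z = MvPolynomial.aeval (Fin.cons (x + algebraMap L R (ν 0))
      (fun i : Fin m => algebraMap L R (ω i) * x + z i * y + algebraMap L R (ν i.succ)) :
        Fin (m + 1) → R) (MvPolynomial.map (algebraMap K L) f) := by
  rw [MvPolynomial.aeval_def, MvPolynomial.eval₂_map]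
  rfl

theorem map_planeSubst {R S : Type*} [CommRing R] [CommRing S] [Algebra L R] [Algebra L S]
    (φ : R →ₐ[L] S) (x y : R) (z : Fin m → R) :
    φ (planeSubst f ν ω R x y z) = planeSubst f ν ω S (φ x) (φ y) (fun i => φ (z i)) := by
  rw [planeSubst_eq_aeval, planeSubst_eq_aeval, MvPolynomial.comp_aeval_apply]
  congr 2
  ext i
  refine Fin.cases ?_ (fun i => ?_) i <;> simp

theorem planeSubst_zero_right (R : Type*) [CommRing R] [Algebra L R] (x : R) (z : Fin m → R) :
    planeSubst f ν ω R x 0 z = planeSubst f ν ω R x 0 0 := by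
  simp [planeSubst]

/-- The univariate polynomial `χ(X, 0)`, which does not involve the parameters `Z`. -/
noncomputable def chiLine : Polynomial L := planeSubst f ν ω (Polynomial L) Polynomial.X 0 0

/-- Each `Z_i` is multiplied by `Y`, so it disappears at `Y = 0`. Consequently the starting values
of the Newton iteration lie in `L`. -/
theorem chiAtZero_eq_map_chiLine : chiAtZero f ν ω = (chiLine f ν ω).map MvPolynomial.C := by
  have h1 := map_planeSubst f ν ω (R := Polynomial (Polynomial (MvPolynomial (Fin m) L)))
    (S := Polynomial (MvPolynomial (Fin m) L)) (Polynomial.mapAlgHom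
    (((Polynomial.aeval (0 : MvPolynomial (Fin m) L)).restrictScalars L) :
      Polynomial (MvPolynomial (Fin m) L) →ₐ[L] MvPolynomial (Fin m) L))
    Polynomial.X (Polynomial.C Polynomial.X)
    (fun i => Polynomial.C (Polynomial.C (MvPolynomial.X i)))
  have h2 := map_planeSubst f ν ω (Polynomial.mapAlgHom
    (Algebra.ofId L (MvPolynomial (Fin m) L))) Polynomial.X 0 0
  simp only [Polynomial.coe_mapAlgHom, Polynomial.map_X, Polynomial.map_C,
    Polynomial.map_zero] at h1 h2
  have e1 : chiAtZero f ν ω = planeSubst f ν ω (Polynomial (MvPolynomial (Fin m) L))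
      Polynomial.X 0 0 := by
    rw [← planeSubst_zero_right f ν ω (Polynomial (MvPolynomial (Fin m) L)) Polynomial.X
      (fun i => Polynomial.C (MvPolynomial.X i))]
    refine Eq.trans ?_ (h1.trans ?_)
    · rfl
    · simp
  refine e1.trans ?_
  exact (planeSubst_zero_right f ν ω _ _ _).symm.trans h2.symm

theorem eval_chi (a : Polynomial (MvPolynomial (Fin m) L)) :
    (chi f ν ω).eval a = planeSubst f ν ω (Polynomial (MvPolynomial (Fin m) L)) a Polynomial.X
      (fun i => Polynomial.C (MvPolynomial.X i)) := by
  have h1 := map_planeSubst f ν ω (R := Polynomial (Polynomial (MvPolynomial (Fin m) L)))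
    (S := Polynomial (MvPolynomial (Fin m) L)) (((Polynomial.aeval a).restrictScalars L) :
      Polynomial (Polynomial (MvPolynomial (Fin m) L)) →ₐ[L] Polynomial (MvPolynomial (Fin m) L))
    Polynomial.X (Polynomial.C Polynomial.X)
    (fun i => Polynomial.C (Polynomial.C (MvPolynomial.X i)))
  simpa [chi, Polynomial.coe_aeval_eq_eval] using h1

theorem aeval_chiAt (a : Polynomial (MvPolynomial (Fin m) L)) (η : Fin m → L) :
    MvPolynomial.aeval ![a.map (MvPolynomial.eval η), Polynomial.X] (chiAt f ν ω η) =
      ((chi f ν ω).eval a).map (MvPolynomial.eval η) := by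
  have h1 := map_planeSubst f ν ω (Polynomial.mapAlgHom (MvPolynomial.aeval η :
    MvPolynomial (Fin m) L →ₐ[L] L)) a Polynomial.X (fun i => Polynomial.C (MvPolynomial.X i))
  rw [eval_chi]
  refine Eq.trans ?_ h1.symm
  rw [chiAt, map_planeSubst]
  simp only [MvPolynomial.aeval_X, Polynomial.coe_mapAlgHom, Polynomial.map_X, Polynomial.map_C,
    MvPolynomial.aeval_C]
  congr 1
  ext1 i
  simp

/-- A factor `Z_i` always comes with a factor `Y`, so the substituted linear forms satisfy the
diagonal bound as soon as `a` does. -/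
theorem totalDegree_coeff_eval_chi_le (a : Polynomial (MvPolynomial (Fin m) L))
    (ha : ∀ k, (a.coeff k).totalDegree ≤ k) (k : ℕ) :
    (((chi f ν ω).eval a).coeff k).totalDegree ≤ k := by
  have hadd : ∀ p q : Polynomial (MvPolynomial (Fin m) L), (∀ k, (p.coeff k).totalDegree ≤ k) →
      (∀ k, (q.coeff k).totalDegree ≤ k) → ∀ k, ((p + q).coeff k).totalDegree ≤ k := by
    intro p q hp hq k
    rw [Polynomial.coeff_add]
    exact (MvPolynomial.totalDegree_add _ _).trans (max_le (hp k) (hq k))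
  rw [eval_chi, planeSubst_eq_aeval]
  refine MvPolynomial.totalDegree_coeff_aeval_le_self _ (fun i => ?_) _ k
  refine Fin.cases ?_ (fun i => ?_) i
  · exact hadd _ _ ha (MvPolynomial.totalDegree_coeff_C_C_le _)
  · refine hadd _ _ (hadd _ _ (MvPolynomial.totalDegree_coeff_mul_le _ _
      (MvPolynomial.totalDegree_coeff_C_C_le _) ha) fun k => ?_)
      (MvPolynomial.totalDegree_coeff_C_C_le _)
    rw [Polynomial.coeff_C_mul, Polynomial.coeff_X]
    split_ifs with h
    · subst h
      rw [mul_one]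
      exact (MvPolynomial.totalDegree_X i).le
    · simp

theorem coeff_zero_eval (q : Polynomial (Polynomial (MvPolynomial (Fin m) L)))
    (a : Polynomial (MvPolynomial (Fin m) L)) :
    (q.eval a).coeff 0 = (q.map (Polynomial.evalRingHom 0)).eval (a.coeff 0) := by
  rw [Polynomial.coeff_zero_eq_eval_zero, Polynomial.coeff_zero_eq_eval_zero, Polynomial.eval_map,
    ← Polynomial.coe_evalRingHom, Polynomial.eval₂_hom]

/-- Newton iteration: a simple root of `χ(X, 0)` lifts to an approximate root of `χ` in `Y`, to any
order, whose coefficient of `Y ^ k` has degree at most `k` in the parameters. -/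
theorem exists_approx_root (α : L) (h0 : (chiLine f ν ω).eval α = 0)
    (h1 : (chiLine f ν ω).derivative.eval α ≠ 0) (N : ℕ) :
    ∃ a : Polynomial (MvPolynomial (Fin m) L), a.coeff 0 = MvPolynomial.C α ∧
      (∀ k, (a.coeff k).totalDegree ≤ k) ∧ Polynomial.X ^ (N + 1) ∣ (chi f ν ω).eval a := by
  have hzero : ∀ a : Polynomial (MvPolynomial (Fin m) L), a.coeff 0 = MvPolynomial.C α →
      ((chi f ν ω).eval a).coeff 0 = 0 := by
    intro a ha
    rw [coeff_zero_eval, ha]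
    change (chiAtZero f ν ω).eval _ = 0
    rw [chiAtZero_eq_map_chiLine, Polynomial.eval_map, Polynomial.eval₂_hom, h0, map_zero]
  have hder : ∀ a : Polynomial (MvPolynomial (Fin m) L), a.coeff 0 = MvPolynomial.C α →
      ((chi f ν ω).derivative.eval a).coeff 0 =
        MvPolynomial.C ((chiLine f ν ω).derivative.eval α) := by
    intro a ha
    rw [coeff_zero_eval, ha, ← Polynomial.derivative_map]
    change (chiAtZero f ν ω).derivative.eval _ = _
    rw [chiAtZero_eq_map_chiLine, Polynomial.derivative_map, Polynomial.eval_map,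
      Polynomial.eval₂_hom]
  induction N with
  | zero =>
    refine ⟨Polynomial.C (MvPolynomial.C α), Polynomial.coeff_C_zero,
      MvPolynomial.totalDegree_coeff_C_C_le _, ?_⟩
    rw [zero_add, pow_one, Polynomial.X_dvd_iff]
    exact hzero _ Polynomial.coeff_C_zero
  | succ N ih =>
    obtain ⟨a, ha0, hadeg, q, hq⟩ := ih
    have hqdeg : (q.coeff 0).totalDegree ≤ N + 1 := by
      have := totalDegree_coeff_eval_chi_le f ν ω a hadeg (N + 1)
      rwa [hq, Polynomial.coeff_X_pow_mul', if_pos le_rfl, Nat.sub_self] at this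
    set d := (chiLine f ν ω).derivative.eval α with hd
    -- The Newton correction. The derivative at `a` has constant term `d`, a nonzero scalar of `L`,
    -- so no denominators in `Z` arise and the degree does not grow.
    set c : MvPolynomial (Fin m) L := -(MvPolynomial.C d⁻¹ * q.coeff 0) with hc
    have hcdeg : c.totalDegree ≤ N + 1 := by
      rw [hc, MvPolynomial.totalDegree_neg]
      refine (MvPolynomial.totalDegree_mul _ _).trans ?_
      simpa using hqdeg
    obtain ⟨r, hr⟩ := (chi f ν ω).binomExpansion a (Polynomial.C c * Polynomial.X ^ (N + 1))
    refine ⟨a + Polynomial.C c * Polynomial.X ^ (N + 1), ?_, ?_, ?_⟩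
    · simp [ha0]
    · intro k
      rw [Polynomial.coeff_add]
      refine (MvPolynomial.totalDegree_add _ _).trans (max_le (hadeg k) ?_)
      rw [Polynomial.coeff_C_mul_X_pow]
      split_ifs with h
      · rw [h]; exact hcdeg
      · simp
    · have h2 : Polynomial.X ∣ q + (chi f ν ω).derivative.eval a * Polynomial.C c := by
        rw [Polynomial.X_dvd_iff, Polynomial.coeff_add, Polynomial.coeff_mul_C, hder a ha0,
          hc, mul_neg, ← mul_assoc, ← map_mul, mul_inv_cancel₀ h1, map_one, one_mul,
          add_neg_cancel]
      obtain ⟨s, hs⟩ := h2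
      -- The quadratic Taylor remainder contributes `Y ^ (2N + 2)`, of which `Y ^ N` is left after
      -- removing `Y ^ (N + 2)`.
      refine ⟨s + r * Polynomial.C c ^ 2 * Polynomial.X ^ N, ?_⟩
      rw [hr, hq]
      linear_combination Polynomial.X ^ (N + 1) * hs

end Substitution

end KaltofenPlane

/-! ### Divisibility from a common approximate root. -/

theorem MvPolynomial.totalDegree_map_eq_of_injective {R S σ : Type*} [CommSemiring R] [CommSemiring S]
    (φ : R →+* S) (hφ : Function.Injective φ) (f : MvPolynomial σ R) :
    (MvPolynomial.map φ f).totalDegree = f.totalDegree := by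
  rw [MvPolynomial.totalDegree, MvPolynomial.support_map_of_injective f hφ]
  rfl

/-- Bivariate polynomials as polynomials in the variable `0` over polynomials in the variable `1`. -/
noncomputable def bivariateEquiv (R : Type*) [CommRing R] :
    MvPolynomial (Fin 2) R ≃ₐ[R] Polynomial (Polynomial R) :=
  (Polynomial.Bivariate.equivMvPolynomial R).symm.trans Polynomial.Bivariate.swap

theorem bivariateEquiv_X_zero (R : Type*) [CommRing R] :
    bivariateEquiv R (MvPolynomial.X 0) = Polynomial.X := by
  rw [bivariateEquiv, AlgEquiv.trans_apply, ← Polynomial.Bivariate.equivMvPolynomial_C_X,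
    AlgEquiv.symm_apply_apply, Polynomial.Bivariate.swap_X]

theorem bivariateEquiv_X_one (R : Type*) [CommRing R] :
    bivariateEquiv R (MvPolynomial.X 1) = Polynomial.C Polynomial.X := by
  rw [bivariateEquiv, AlgEquiv.trans_apply, ← Polynomial.Bivariate.equivMvPolynomial_X,
    AlgEquiv.symm_apply_apply, Polynomial.Bivariate.swap_Y]

theorem bivariateEquiv_eq_aeval {R : Type*} [CommRing R] (G : MvPolynomial (Fin 2) R) :
    bivariateEquiv R G = MvPolynomial.aeval (![Polynomial.X, Polynomial.C Polynomial.X] : Fin 2 → Polynomial (Polynomial R)) G := by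
  have : (bivariateEquiv R).toAlgHom =
      MvPolynomial.aeval (![Polynomial.X, Polynomial.C Polynomial.X] : Fin 2 → Polynomial (Polynomial R)) := by
    ext1 i
    fin_cases i
    · simpa using bivariateEquiv_X_zero R
    · simpa using bivariateEquiv_X_one R
  exact DFunLike.congr_fun this G

theorem eval_bivariateEquiv {R : Type*} [CommRing R] (G : MvPolynomial (Fin 2) R)
    (a : Polynomial R) :
    (bivariateEquiv R G).eval a = MvPolynomial.aeval ![a, Polynomial.X] G := by
  rw [bivariateEquiv_eq_aeval]
  have : (((Polynomial.aeval a).restrictScalars R :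
      Polynomial (Polynomial R) →ₐ[R] Polynomial R).comp
      (MvPolynomial.aeval (![Polynomial.X, Polynomial.C Polynomial.X] : Fin 2 → Polynomial (Polynomial R)))) =
      MvPolynomial.aeval ![a, Polynomial.X] := by
    ext1 i
    fin_cases i <;> simp
  have := DFunLike.congr_fun this G
  simpa [Polynomial.coe_aeval_eq_eval] using this

theorem natDegree_bivariateEquiv_le {R : Type*} [CommRing R] (G : MvPolynomial (Fin 2) R) :
    (bivariateEquiv R G).natDegree ≤ G.totalDegree := by
  rw [bivariateEquiv_eq_aeval]
  refine Polynomial.natDegree_aeval_le (R := Polynomial R)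
    ![Polynomial.X, Polynomial.C Polynomial.X] (fun i => ?_) G
  fin_cases i
  · simpa using Polynomial.natDegree_X_le
  · simp

theorem natDegree_coeff_bivariateEquiv_le {R : Type*} [CommRing R] (G : MvPolynomial (Fin 2) R)
    (k : ℕ) : ((bivariateEquiv R G).coeff k).natDegree ≤ G.totalDegree := by
  rw [bivariateEquiv_eq_aeval]
  refine Polynomial.natDegree_coeff_aeval_le (R := R)
    ![Polynomial.X, Polynomial.C Polynomial.X] (fun i k => ?_) G k
  fin_cases i
  · simp only [Fin.zero_eta, Matrix.cons_val_zero, Polynomial.coeff_X]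
    split_ifs <;> simp
  · simp only [Fin.mk_one, Matrix.cons_val_one, Matrix.cons_val_fin_one, Polynomial.coeff_C]
    split_ifs <;> simp [Polynomial.natDegree_X_le]

/-- If an irreducible `P` and `G` have a common root to an order in `Y` exceeding the degree of
their resultant, then `P` divides `G`. -/
theorem Polynomial.dvd_of_X_pow_dvd_eval {R : Type*} [CommRing R] [IsDomain R]
    [UniqueFactorizationMonoid R] (P G : Polynomial (Polynomial R)) (hP : Irreducible P)
    (hPdeg : P.natDegree ≠ 0) (c d N : ℕ) (hPc : ∀ k, (P.coeff k).natDegree ≤ c)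
    (hGc : ∀ k, (G.coeff k).natDegree ≤ d) (hN : P.natDegree * d + G.natDegree * c ≤ N)
    (a : Polynomial R) (hPa : Polynomial.X ^ (N + 1) ∣ P.eval a)
    (hGa : Polynomial.X ^ (N + 1) ∣ G.eval a) : P ∣ G := by
  have hres : Polynomial.resultant P G = 0 := by
    -- The resultant is a combination of `P` and `G` and is free of `X`; evaluation at `X = a` shows
    -- that `Y ^ (N + 1)` divides it, beyond its degree.
    obtain ⟨p, q, -, -, hpq⟩ := Polynomial.exists_mul_add_mul_eq_C_resultant
      (m := P.natDegree) (n := G.natDegree) P G le_rfl le_rfl (Or.inl hPdeg)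
    have h1 := congrArg (Polynomial.eval a) hpq
    rw [Polynomial.eval_add, Polynomial.eval_mul, Polynomial.eval_mul, Polynomial.eval_C] at h1
    have h2 : Polynomial.X ^ (N + 1) ∣ Polynomial.resultant P G := by
      rw [← h1]
      exact dvd_add (hPa.mul_right _) (hGa.mul_right _)
    by_contra hne
    have h3 := Polynomial.natDegree_le_of_dvd h2 hne
    rw [Polynomial.natDegree_X_pow] at h3
    have h4 := Polynomial.natDegree_resultant_le P G P.natDegree G.natDegree c d hPc hGc
    omega
  let F := FractionRing (Polynomial R)
  have hinj := IsFractionRing.injective (Polynomial R) F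
  have hprim := hP.isPrimitive hPdeg
  have hirr := (hprim.irreducible_iff_irreducible_map_fraction_map (K := F)).1 hP
  refine hprim.dvd_of_fraction_map_dvd_fraction_map (K := F) ?_
  -- By Gauss's lemma `P` stays irreducible over the fraction field, so it divides `G` or is coprime
  -- to it; the latter would make the resultant nonzero.
  refine (EuclideanDomain.dvd_or_coprime _ _ hirr).resolve_right fun hcop => ?_
  refine Polynomial.resultant_ne_zero _ _ hcop ?_
  rw [Polynomial.natDegree_map_eq_of_injective hinj, Polynomial.natDegree_map_eq_of_injective hinj,
    Polynomial.resultant_map_map, hres, map_zero]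

/-! ### Degrees of `χ`. -/

namespace KaltofenPlane

variable {K L : Type*} [Field K] [Field L] [Algebra K L] {m : ℕ}
  (f : MvPolynomial (Fin (m + 1)) K) (ν : Fin (m + 1) → L) (ω : Fin m → L)

theorem natDegree_chi_le : (chi f ν ω).natDegree ≤ f.totalDegree := by
  rw [chi, planeSubst_eq_aeval,
    ← MvPolynomial.totalDegree_map_eq_of_injective (algebraMap K L) (algebraMap K L).injective f]
  refine Polynomial.natDegree_aeval_le _ (fun i => ?_) _
  refine Fin.cases ?_ (fun i => ?_) i
  · simp only [Fin.cons_zero, Polynomial.algebraMap_apply]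
    compute_degree
  · simp only [Fin.cons_succ, Polynomial.algebraMap_apply]
    rw [← Polynomial.C_mul]
    compute_degree

theorem natDegree_coeff_chi_le (k : ℕ) : ((chi f ν ω).coeff k).natDegree ≤ f.totalDegree := by
  rw [chi, planeSubst_eq_aeval,
    ← MvPolynomial.totalDegree_map_eq_of_injective (algebraMap K L) (algebraMap K L).injective f]
  refine Polynomial.natDegree_coeff_aeval_le _ (fun i k => ?_) _ k
  refine Fin.cases ?_ (fun i => ?_) i
  · simp only [Fin.cons_zero, Polynomial.algebraMap_apply, Polynomial.coeff_add,
      Polynomial.coeff_X, Polynomial.coeff_C]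
    split_ifs <;> compute_degree <;> simp
  · simp only [Fin.cons_succ, Polynomial.algebraMap_apply, ← Polynomial.C_mul,
      Polynomial.coeff_add, Polynomial.coeff_C_mul, Polynomial.coeff_X, Polynomial.coeff_C]
    split_ifs <;> compute_degree <;> simp

/-- The total degree of `χ` in `X` and `Y` is not smaller than that of `f`. -/
theorem totalDegree_le_of_bivariateEquiv_eq_chi (hf : f ≠ 0)
    (H : MvPolynomial (Fin 2) (MvPolynomial (Fin m) L))
    (hH : bivariateEquiv (MvPolynomial (Fin m) L) H = chi f ν ω) :
    f.totalDegree ≤ H.totalDegree := by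
  let g := MvPolynomial.map (algebraMap K L) f
  have hinj := (algebraMap K L).injective
  have hgd : g.totalDegree = f.totalDegree := MvPolynomial.totalDegree_map_eq_of_injective _ hinj f
  have hg : g ≠ 0 := by
    rwa [Ne, map_eq_zero_iff _ (MvPolynomial.map_injective _ hinj)]
  -- Put `X = sT`, `Y = T`, with `T` the outer variable and `s` the inner one. The degree in `T` is
  -- at most the total degree of `H`, and the coefficient of `T ^ δ` is the top form of `f` at `(s,
  -- ω_i s + Z_i)`.
  let t : Fin 2 → Polynomial (Polynomial (MvPolynomial (Fin m) L)) :=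
    ![Polynomial.C Polynomial.X * Polynomial.X, Polynomial.X]
  let b : Fin (m + 1) → Polynomial (MvPolynomial (Fin m) L) := fun i => algebraMap L _ (ν i)
  let c : Fin (m + 1) → Polynomial (MvPolynomial (Fin m) L) := Fin.cons Polynomial.X
    (fun i => algebraMap L _ (ω i) * Polynomial.X + Polynomial.C (MvPolynomial.X i))
  have hH' : H = planeSubst f ν ω (MvPolynomial (Fin 2) (MvPolynomial (Fin m) L)) (MvPolynomial.X 0) (MvPolynomial.X 1)
      (fun i => MvPolynomial.C (MvPolynomial.X i)) := by
    apply (bivariateEquiv (MvPolynomial (Fin m) L)).injective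
    have h1 := map_planeSubst f ν ω (R := MvPolynomial (Fin 2) (MvPolynomial (Fin m) L)) (S := Polynomial (Polynomial (MvPolynomial (Fin m) L)))
      ((bivariateEquiv (MvPolynomial (Fin m) L)).toAlgHom.restrictScalars L) (MvPolynomial.X 0) (MvPolynomial.X 1)
      (fun i => MvPolynomial.C (MvPolynomial.X i))
    refine hH.trans (Eq.trans ?_ h1.symm)
    have hC : (fun i : Fin m => ((bivariateEquiv (MvPolynomial (Fin m) L)).toAlgHom.restrictScalars L)
        (MvPolynomial.C (MvPolynomial.X i))) =
        fun i => Polynomial.C (Polynomial.C (MvPolynomial.X i)) := by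
      funext i
      exact (bivariateEquiv (MvPolynomial (Fin m) L)).commutes (MvPolynomial.X i)
    rw [chi, hC]
    congr 1
    · exact (bivariateEquiv_X_zero _).symm
    · exact (bivariateEquiv_X_one _).symm
  have h2 : MvPolynomial.aeval t H = MvPolynomial.aeval
      (fun i => Polynomial.C (b i) + Polynomial.C (c i) * Polynomial.X) g := by
    have h1 := map_planeSubst f ν ω (R := MvPolynomial (Fin 2) (MvPolynomial (Fin m) L)) (S := Polynomial (Polynomial (MvPolynomial (Fin m) L)))
      ((MvPolynomial.aeval t : MvPolynomial (Fin 2) (MvPolynomial (Fin m) L) →ₐ[MvPolynomial (Fin m) L] _).restrictScalars L)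
      (MvPolynomial.X 0) (MvPolynomial.X 1) (fun i => MvPolynomial.C (MvPolynomial.X i))
    rw [hH']
    refine h1.trans ?_
    rw [planeSubst_eq_aeval]
    congr 2
    ext1 i
    refine Fin.cases ?_ (fun i => ?_) i
    · simp [t, b, c, Polynomial.algebraMap_apply, add_comm]
    · simp only [AlgHom.restrictScalars_apply, MvPolynomial.aeval_X, MvPolynomial.algHom_C,
        Polynomial.algebraMap_apply, t, b, c, Fin.cons_succ, Matrix.cons_val_zero,
        Matrix.cons_val_one, Algebra.algebraMap_self, RingHom.id_apply, map_add, map_mul]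
      ring
  have h3 : (MvPolynomial.aeval t H).natDegree ≤ H.totalDegree := by
    refine Polynomial.natDegree_aeval_le _ (fun i => ?_) H
    fin_cases i
    · exact (Polynomial.natDegree_C_mul_le _ _).trans Polynomial.natDegree_X_le
    · exact Polynomial.natDegree_X_le
  refine le_trans ?_ h3
  apply Polynomial.le_natDegree_of_ne_zero
  rw [h2, MvPolynomial.coeff_aeval_line b c g _ hgd.le, ← hgd]
  -- `(s, Z) ↦ (s, ω s + Z)` is an invertible linear change of variables, so it cannot kill the top
  -- form.
  have hcinj : Function.Injective (MvPolynomial.aeval c : MvPolynomial (Fin (m + 1)) L →ₐ[L] _) := by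
    let ψ : MvPolynomial (Fin (m + 1)) L →ₐ[L] Polynomial (MvPolynomial (Fin m) L) := MvPolynomial.aeval c
    let back : Polynomial (MvPolynomial (Fin m) L) →+* MvPolynomial (Fin (m + 1)) L := Polynomial.eval₂RingHom
      (MvPolynomial.aeval (R := L) (fun i : Fin m => (MvPolynomial.X i.succ -
        MvPolynomial.C (ω i) * MvPolynomial.X 0 : MvPolynomial (Fin (m + 1)) L))).toRingHom
      (MvPolynomial.X 0)
    have hback : back.comp ψ.toRingHom = RingHom.id _ := by
      apply MvPolynomial.ringHom_ext
      · intro r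
        simp [back, ψ, Polynomial.algebraMap_apply]
      · intro i
        refine Fin.cases ?_ (fun i => ?_) i
        · simp [back, ψ, c]
        · simp [back, ψ, c, Polynomial.algebraMap_apply, MvPolynomial.algebraMap_eq]
    exact Function.LeftInverse.injective (g := back) fun x => RingHom.congr_fun hback x
  rw [Ne, map_eq_zero_iff _ hcinj]
  exact MvPolynomial.homogeneousComponent_totalDegree_ne_zero g hg

end KaltofenPlane

/-! ### Simple roots from the discriminant. -/

/-- The resultant of `p` and `p'` is a combination of the two, so it would vanish at a common root;
up to sign its image is the leading coefficient times the discriminant. -/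
theorem Polynomial.derivative_eval_ne_zero_of_discr_map_ne_zero {L B : Type*} [Field L]
    [CommRing B] [IsDomain B] (φ : L →+* B) (p : Polynomial L) (hp : 0 < p.natDegree)
    (hd : (p.map φ).discr ≠ 0) (α : L) (hα : p.eval α = 0) : p.derivative.eval α ≠ 0 := by
  intro hα'
  have hinj := φ.injective
  have hdeg : (p.map φ).natDegree = p.natDegree := Polynomial.natDegree_map_eq_of_injective hinj p
  have h1 := Polynomial.resultant_deriv (f := p.map φ)
    (by rw [← Polynomial.natDegree_pos_iff_degree_pos, hdeg]; exact hp)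
  rw [Polynomial.derivative_map, hdeg, Polynomial.resultant_map_map] at h1
  obtain ⟨u, v, -, -, huv⟩ := Polynomial.exists_mul_add_mul_eq_C_resultant (m := p.natDegree)
    (n := p.natDegree - 1) p p.derivative le_rfl (Polynomial.natDegree_derivative_le p)
    (Or.inl hp.ne')
  have h2 := congrArg (Polynomial.eval α) huv
  rw [Polynomial.eval_add, Polynomial.eval_mul, Polynomial.eval_mul, hα, hα', zero_mul, zero_mul,
    add_zero, Polynomial.eval_C] at h2
  rw [← h2, map_zero] at h1
  have hlc : (p.map φ).leadingCoeff ≠ 0 := by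
    rw [Ne, Polynomial.leadingCoeff_eq_zero]
    intro h
    rw [h, Polynomial.natDegree_zero] at hdeg
    omega
  exact mul_ne_zero (mul_ne_zero (pow_ne_zero _ (neg_ne_zero.2 one_ne_zero)) hlc) hd h1.symm

theorem Polynomial.eval_eval_bivariateEquiv {R : Type*} [CommRing R]
    (G : MvPolynomial (Fin 2) R) (a : Polynomial R) (b : R) :
    ((bivariateEquiv R G).eval a).eval b =
      ((bivariateEquiv R G).map (Polynomial.evalRingHom b)).eval (a.eval b) := by
  rw [Polynomial.eval_map, ← Polynomial.coe_evalRingHom, Polynomial.eval₂_hom]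

/-! ### Factors of plane sections in generic position: part (b). -/

namespace KaltofenPlane

variable {K L : Type*} [Field K] [Field L] [Algebra K L] {m : ℕ}
  {f : MvPolynomial (Fin (m + 1)) K} {ν : Fin (m + 1) → L} {ω : Fin m → L}

theorem IsGenericPosition.natDegree_chi_pos (h : IsGenericPosition f ν ω) :
    0 < (chi f ν ω).natDegree := by
  obtain ⟨c, hc, hlc⟩ := h.leadingCoeff_const
  rw [Nat.pos_iff_ne_zero]
  intro h0
  refine h.irreducible.not_isUnit ?_
  rw [Polynomial.eq_C_of_natDegree_eq_zero h0]
  rw [Polynomial.leadingCoeff, h0] at hlc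
  rw [hlc]
  exact (((isUnit_iff_ne_zero.2 hc).map MvPolynomial.C).map Polynomial.C).map Polynomial.C

theorem IsGenericPosition.natDegree_chiLine (h : IsGenericPosition f ν ω) :
    (chiLine f ν ω).natDegree = (chi f ν ω).natDegree := by
  obtain ⟨c, hc, hlc⟩ := h.leadingCoeff_const
  rw [← Polynomial.natDegree_map_eq_of_injective (MvPolynomial.C_injective (Fin m) L)
    (chiLine f ν ω), ← chiAtZero_eq_map_chiLine, chiAtZero]
  apply Polynomial.natDegree_map_of_leadingCoeff_ne_zero
  rw [hlc]
  simpa using hc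

/-- Approximate roots of `χ` to order `2 D δ` are not approximate roots of a nonzero polynomial of
total degree at most `D`. -/
theorem IsGenericPosition.eq_zero_of_X_pow_dvd (h : IsGenericPosition f ν ω) (hf : f ≠ 0)
    {D : ℕ} (hD : D < f.totalDegree) (a : Polynomial (MvPolynomial (Fin m) L))
    (ha : Polynomial.X ^ (2 * D * f.totalDegree + 1) ∣ (chi f ν ω).eval a)
    (G : MvPolynomial (Fin 2) (MvPolynomial (Fin m) L)) (hG : G.totalDegree ≤ D)
    (hGa : Polynomial.X ^ (2 * D * f.totalDegree + 1) ∣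
      MvPolynomial.aeval ![a, Polynomial.X] G) : G = 0 := by
  have hdvd : chi f ν ω ∣ bivariateEquiv (MvPolynomial (Fin m) L) G := by
    refine Polynomial.dvd_of_X_pow_dvd_eval _ _ h.irreducible h.natDegree_chi_pos.ne'
      f.totalDegree D (2 * D * f.totalDegree) (natDegree_coeff_chi_le f ν ω)
      (fun k => (natDegree_coeff_bivariateEquiv_le G k).trans hG) ?_ a ha
      (by rwa [eval_bivariateEquiv])
    have h1 := Nat.mul_le_mul_right D (natDegree_chi_le f ν ω)
    have h2 := Nat.mul_le_mul_right f.totalDegree ((natDegree_bivariateEquiv_le G).trans hG)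
    nlinarith
  by_contra hne
  obtain ⟨Q, hQ⟩ := hdvd
  set E := bivariateEquiv (MvPolynomial (Fin m) L)
  have hGQ : G = E.symm (chi f ν ω) * E.symm Q := by
    apply E.injective
    rw [map_mul, AlgEquiv.apply_symm_apply, AlgEquiv.apply_symm_apply, hQ]
  have h1 := totalDegree_le_of_bivariateEquiv_eq_chi f ν ω hf (E.symm (chi f ν ω))
    (AlgEquiv.apply_symm_apply _ _)
  have hne1 : E.symm (chi f ν ω) ≠ 0 := fun h0 => hne (by rw [hGQ, h0, zero_mul])
  have hne2 : E.symm Q ≠ 0 := fun h0 => hne (by rw [hGQ, h0, mul_zero])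
  -- Total degrees add over a domain, so a nonzero multiple of `χ` has degree at least `δ > D`.
  have h2 := MvPolynomial.totalDegree_mul_of_isDomain hne1 hne2
  rw [← hGQ] at h2
  omega

theorem bivariateEquiv_chiAt (f : MvPolynomial (Fin (m + 1)) K) (ν : Fin (m + 1) → L)
    (ω η : Fin m → L) : bivariateEquiv L (chiAt f ν ω η) =
      (chi f ν ω).map (Polynomial.mapRingHom (MvPolynomial.eval η)) := by
  have h1 := map_planeSubst f ν ω (R := Polynomial (Polynomial (MvPolynomial (Fin m) L)))
    (S := Polynomial (Polynomial L)) (Polynomial.mapAlgHom (Polynomial.mapAlgHom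
      (MvPolynomial.aeval η : MvPolynomial (Fin m) L →ₐ[L] L)))
    Polynomial.X (Polynomial.C Polynomial.X)
    (fun i => Polynomial.C (Polynomial.C (MvPolynomial.X i)))
  have h2 := map_planeSubst f ν ω (bivariateEquiv L).toAlgHom (MvPolynomial.X 0)
    (MvPolynomial.X 1) (fun i => MvPolynomial.C (η i))
  refine (h2.trans ?_).trans h1.symm
  have hC : ∀ r, (bivariateEquiv L).toAlgHom (MvPolynomial.C r) = Polynomial.C (Polynomial.C r) :=
    (bivariateEquiv L).commutes
  have hX0 : (bivariateEquiv L).toAlgHom (MvPolynomial.X 0) = Polynomial.X :=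
    bivariateEquiv_X_zero L
  have hX1 : (bivariateEquiv L).toAlgHom (MvPolynomial.X 1) = Polynomial.C Polynomial.X :=
    bivariateEquiv_X_one L
  simp only [hC, hX0, hX1]
  congr 1
  · simp
  · simp
  · funext i
    simp

/-- The restriction to `Y = 0` of the plane section is the polynomial `χ(X, 0)`. -/
theorem bivariateEquiv_chiAt_map_eval_zero (f : MvPolynomial (Fin (m + 1)) K)
    (ν : Fin (m + 1) → L) (ω η : Fin m → L) :
    (bivariateEquiv L (chiAt f ν ω η)).map (Polynomial.evalRingHom 0) = chiLine f ν ω := by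
  have h1 := map_planeSubst f ν ω (R := MvPolynomial (Fin 2) L) (S := Polynomial L)
    (((Polynomial.mapAlgHom (Polynomial.aeval (0 : L))) : Polynomial (Polynomial L) →ₐ[L] _).comp
      (bivariateEquiv L).toAlgHom) (MvPolynomial.X 0)
    (MvPolynomial.X 1) (fun i => MvPolynomial.C (η i))
  refine Eq.trans ?_ (h1.trans ?_)
  · rw [AlgHom.comp_apply, Polynomial.coe_mapAlgHom]
    congr 1
  · have hX0 : (bivariateEquiv L).toAlgHom (MvPolynomial.X 0) = Polynomial.X :=
      bivariateEquiv_X_zero L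
    have hX1 : (bivariateEquiv L).toAlgHom (MvPolynomial.X 1) = Polynomial.C Polynomial.X :=
      bivariateEquiv_X_one L
    simp only [AlgHom.comp_apply, hX0, hX1]
    simp only [Polynomial.coe_mapAlgHom, Polynomial.map_X, Polynomial.map_C, RingHom.coe_coe,
      Polynomial.aeval_X, map_zero]
    exact planeSubst_zero_right f ν ω _ _ _

/-- A nonunit factor of a plane section restricts to a polynomial of positive degree on `Y = 0`. -/
theorem IsGenericPosition.natDegree_factor_pos (h : IsGenericPosition f ν ω) (η : Fin m → L)
    (g : MvPolynomial (Fin 2) L) (hg : ¬ IsUnit g) (hdvd : g ∣ chiAt f ν ω η) :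
    0 < ((bivariateEquiv L g).map (Polynomial.evalRingHom 0)).natDegree := by
  obtain ⟨c, hc, hlc⟩ := h.leadingCoeff_const
  have hlc' : (bivariateEquiv L (chiAt f ν ω η)).leadingCoeff = Polynomial.C c := by
    rw [bivariateEquiv_chiAt, Polynomial.leadingCoeff_map_of_leadingCoeff_ne_zero, hlc]
    · simp
    · rw [hlc]
      simpa using hc
  obtain ⟨q, hq⟩ := hdvd
  rw [hq, map_mul, Polynomial.leadingCoeff_mul] at hlc'
  -- The leading coefficient of `g` divides a nonzero constant, so the degree in `X` does not drop
  -- at `Y = 0`.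
  have hunit : IsUnit (bivariateEquiv L g).leadingCoeff := by
    refine isUnit_of_dvd_unit (Dvd.intro _ hlc') ?_
    exact (isUnit_iff_ne_zero.2 hc).map Polynomial.C
  rw [Polynomial.natDegree_map_eq_of_isUnit_leadingCoeff _ hunit, Nat.pos_iff_ne_zero]
  intro h0
  apply hg
  rw [Polynomial.leadingCoeff, h0] at hunit
  have := hunit.map Polynomial.C
  rw [← Polynomial.eq_C_of_natDegree_eq_zero h0] at this
  have := this.map (bivariateEquiv L).symm
  rwa [AlgEquiv.symm_apply_apply] at this

/-- One minor is taken for each root of `χ(X, 0)`, and `Ψ` is their product: a factor `g` vanishes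
at one of these roots on `Y = 0`, and the minor of that root excludes it. -/
theorem IsGenericPosition.exists_factor_bound [IsAlgClosed L] (h : IsGenericPosition f ν ω)
    (hf : f ≠ 0) {D : ℕ} (hD : D < f.totalDegree) :
    ∃ Ψ : MvPolynomial (Fin m) L, Ψ ≠ 0 ∧
      2 * Ψ.totalDegree ≤ f.totalDegree * (2 * (2 * D * f.totalDegree *
        Fintype.card (BivariateIndex D)) - Fintype.card (BivariateIndex D) *
          (Fintype.card (BivariateIndex D) - 1)) ∧
      ∀ η : Fin m → L, MvPolynomial.eval η Ψ ≠ 0 →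
        ∀ g : MvPolynomial (Fin 2) L, Irreducible g → g.totalDegree ≤ D →
          ¬ g ∣ chiAt f ν ω η := by
  classical
  set N := 2 * D * f.totalDegree with hN
  have hsimple : ∀ α : L, (chiLine f ν ω).eval α = 0 →
      (chiLine f ν ω).derivative.eval α ≠ 0 := by
    refine Polynomial.derivative_eval_ne_zero_of_discr_map_ne_zero
      (MvPolynomial.C : L →+* MvPolynomial (Fin m) L) _ ?_ ?_
    · rw [h.natDegree_chiLine]
      exact h.natDegree_chi_pos
    · rw [← chiAtZero_eq_map_chiLine]
      exact h.discr_ne_zero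
  have hroots : (chiLine f ν ω) ≠ 0 := by
    intro h0
    have := h.natDegree_chiLine
    rw [h0, Polynomial.natDegree_zero] at this
    exact h.natDegree_chi_pos.ne this
  -- The root condition sits inside the existential so that `choose` yields a total function of `α`;
  -- off the roots its value is the dummy `0`.
  have hmain : ∀ α : L, ∃ Ψ : MvPolynomial (Fin m) L, (chiLine f ν ω).eval α = 0 → Ψ ≠ 0 ∧
      2 * Ψ.totalDegree + Fintype.card (BivariateIndex D) * (Fintype.card (BivariateIndex D) - 1)
        ≤ 2 * (N * Fintype.card (BivariateIndex D)) ∧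
      ∀ η : Fin m → L, MvPolynomial.eval η Ψ ≠ 0 →
        ∀ g : MvPolynomial (Fin 2) L, Irreducible g → g.totalDegree ≤ D →
          ((bivariateEquiv L g).map (Polynomial.evalRingHom 0)).eval α = 0 →
          ¬ g ∣ chiAt f ν ω η := by
    intro α
    by_cases hα : (chiLine f ν ω).eval α = 0
    swap
    · exact ⟨0, fun h0 => absurd h0 hα⟩
    obtain ⟨a, ha0, hadeg, ha⟩ := exists_approx_root f ν ω α hα (hsimple α hα) N
    obtain ⟨Ψ, hΨ0, hΨd, hΨ⟩ := exists_minor_of_truncatedValueMatrix D N a hadeg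
      (h.eq_zero_of_X_pow_dvd hf hD a ha)
    refine ⟨Ψ, fun _ => ⟨hΨ0, hΨd, ?_⟩⟩
    rintro η hη g hg hgD hgα ⟨q, hq⟩
    refine hg.ne_zero (hΨ η hη g hgD ?_)
    have hsplit : MvPolynomial.aeval ![a.map (MvPolynomial.eval η), Polynomial.X] g *
        MvPolynomial.aeval ![a.map (MvPolynomial.eval η), Polynomial.X] q =
        ((chi f ν ω).eval a).map (MvPolynomial.eval η) := by
      rw [← map_mul, ← hq, aeval_chiAt]
    have hdvd : Polynomial.X ^ (N + 1) ∣ ((chi f ν ω).eval a).map (MvPolynomial.eval η) := by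
      have := Polynomial.map_dvd (MvPolynomial.eval η) ha
      rwa [Polynomial.map_pow, Polynomial.map_X] at this
    rw [← hsplit] at hdvd
    -- The whole power of `Y` passes to `g(a, Y)` because `q(a, Y)` has nonzero constant term;
    -- otherwise `α` would be a double root of `χ(X, 0)`.
    refine Polynomial.prime_X.pow_dvd_of_dvd_mul_right _ ?_ hdvd
    rw [Polynomial.X_dvd_iff, Polynomial.coeff_zero_eq_eval_zero, ← eval_bivariateEquiv,
      Polynomial.eval_eval_bivariateEquiv, ← Polynomial.coeff_zero_eq_eval_zero,
      Polynomial.coeff_map, ha0, MvPolynomial.eval_C]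
    intro hqα
    apply hsimple α hα
    rw [← bivariateEquiv_chiAt_map_eval_zero f ν ω η, hq, map_mul, Polynomial.map_mul,
      Polynomial.derivative_mul, Polynomial.eval_add, Polynomial.eval_mul, Polynomial.eval_mul,
      hgα, hqα, mul_zero, zero_mul, add_zero]
  choose Ψ hΨ using hmain
  refine ⟨∏ α ∈ (chiLine f ν ω).roots.toFinset, Ψ α, ?_, ?_, ?_⟩
  · refine Finset.prod_ne_zero_iff.2 fun α hα => (hΨ α ?_).1
    exact (Polynomial.mem_roots'.1 (Multiset.mem_toFinset.1 hα)).2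
  · have h1 := MvPolynomial.totalDegree_finsetProd (chiLine f ν ω).roots.toFinset Ψ
    have h2 : (chiLine f ν ω).roots.toFinset.card ≤ f.totalDegree :=
      (Multiset.toFinset_card_le _).trans ((Polynomial.card_roots' _).trans
        (h.natDegree_chiLine.trans_le (natDegree_chi_le f ν ω)))
    refine (Nat.mul_le_mul_left 2 h1).trans ?_
    rw [Finset.mul_sum]
    refine (Finset.sum_le_card_nsmul _ _ _ fun α hα => ?_).trans
      (by rw [smul_eq_mul]; exact Nat.mul_le_mul_right _ h2)
    have := (hΨ α (Polynomial.mem_roots'.1 (Multiset.mem_toFinset.1 hα)).2).2.1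
    omega
  · intro η hη g hg hgD hdvd
    rw [map_prod, Finset.prod_ne_zero_iff] at hη
    have hpos := h.natDegree_factor_pos η g hg.not_isUnit hdvd
    obtain ⟨α, hα⟩ := IsAlgClosed.exists_root
      ((bivariateEquiv L g).map (Polynomial.evalRingHom 0))
      (Polynomial.natDegree_pos_iff_degree_pos.1 hpos).ne'
    have hroot : (chiLine f ν ω).eval α = 0 := by
      obtain ⟨q, hq⟩ := hdvd
      rw [← bivariateEquiv_chiAt_map_eval_zero f ν ω η, hq, map_mul, Polynomial.map_mul,
        Polynomial.eval_mul, hα.eq_zero, zero_mul]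
    refine (hΨ α hroot).2.2 η (hη α ?_) g hg hgD hα hdvd
    exact Multiset.mem_toFinset.2 (Polynomial.mem_roots'.2 ⟨hroots, hroot⟩)

theorem cast_degree_bound {D δ M t : ℕ} (hM : 2 * M = (D + 1) * (D + 2)) (hδ : D + 1 ≤ δ)
    (ht : 2 * t ≤ δ * (2 * (2 * D * δ * M) - M * (M - 1))) (hD : 1 ≤ D) :
    (t : ℚ) ≤ (D : ℚ) * δ ^ 2 * (D + 1) * (D + 2)
      - ((D : ℚ) ^ 2 + 3 * D) * ((D : ℚ) ^ 2 + 3 * D + 2) * δ / 8 := by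
  have hM1 : 1 ≤ M := by nlinarith
  -- This makes the truncated subtraction in `ht` a true one, so that it can be cast to `ℚ`.
  have hle : M * (M - 1) ≤ 2 * (2 * D * δ * M) := by
    obtain ⟨k, rfl⟩ : ∃ k, M = k + 1 := ⟨M - 1, by omega⟩
    rw [Nat.add_sub_cancel]
    have h1 : k ≤ 4 * D * δ := by nlinarith
    nlinarith
  have hq : (2 * t : ℚ) ≤ δ * (2 * (2 * D * δ * M) - M * (M - 1)) := by
    have : ((2 * t : ℕ) : ℚ) ≤ ((δ * (2 * (2 * D * δ * M) - M * (M - 1)) : ℕ) : ℚ) := by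
      exact_mod_cast ht
    rw [Nat.cast_mul δ, Nat.cast_sub hle] at this
    push_cast [Nat.cast_sub hM1] at this
    exact this
  have hMq : (M : ℚ) = (D + 1) * (D + 2) / 2 := by
    have : ((2 * M : ℕ) : ℚ) = (((D + 1) * (D + 2) : ℕ) : ℚ) := by exact_mod_cast hM
    push_cast at this
    linarith
  rw [hMq] at hq
  linarith

end KaltofenPlane

/-! ### Partial derivatives, primes and homogeneous forms. -/

namespace MvPolynomial

/-- An irreducible polynomial over an algebraically closed field has a nonzero partial
derivative. -/
theorem exists_pderiv_ne_zero {L σ : Type*} [Field L] [IsAlgClosed L] (f : MvPolynomial σ L)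
    (hf : Irreducible f) : ∃ i, pderiv i f ≠ 0 := by
  by_contra! h
  have hs : ∀ s ∈ f.support, ∀ i, ((s i : ℕ) : L) = 0 := by
    intro s hs i
    rcases Nat.eq_zero_or_pos (s i) with h0 | h0
    · simp [h0]
    have h1 := coeff_pderiv (i := i) f (s - Finsupp.single i 1)
    rw [h i, coeff_zero, tsub_add_cancel_of_le (Finsupp.single_le_iff.2 h0)] at h1
    have h2 := (mul_eq_zero.1 h1.symm).resolve_left (mem_support_iff.1 hs)
    have h4 : (s - Finsupp.single i 1 : σ →₀ ℕ) i + 1 = s i := by simp; omega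
    rw [← h4]
    exact_mod_cast h2
  obtain ⟨p, hp⟩ := CharP.exists L
  rcases CharP.char_is_prime_or_zero L p with hpp | rfl
  · have : Fact p.Prime := ⟨hpp⟩
    choose r hr using fun a : L => IsAlgClosed.exists_pow_nat_eq a hpp.pos
    have hdvd : ∀ s ∈ f.support, ∃ t : σ →₀ ℕ, s = p • t := by
      intro s hs'
      choose t ht using fun i => (CharP.cast_eq_zero_iff L p (s i)).1 (hs s hs' i)
      refine ⟨Finsupp.onFinset s.support t fun i hi => ?_, ?_⟩
      · rw [Finsupp.mem_support_iff, ht]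
        exact mul_ne_zero hpp.ne_zero hi
      · ext i
        simp [ht i]
    choose! t ht using hdvd
    -- In characteristic `p` all exponents are multiples of `p` and all coefficients are `p`-th
    -- powers, so `f` is a `p`-th power by Frobenius.
    have hpow : f = (∑ s ∈ f.support, monomial (t s) (r (f.coeff s))) ^ p := by
      rw [sum_pow_char]
      conv_lhs => rw [f.as_sum]
      refine Finset.sum_congr rfl fun s hs' => ?_
      rw [monomial_pow, ← ht s hs', hr]
    rw [hpow] at hf
    exact not_irreducible_pow hpp.ne_one hf
  · have : CharZero L := CharP.charP_to_charZero L
    have hd : f.totalDegree = 0 := by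
      rw [totalDegree_eq_zero_iff]
      exact fun s hs' i => by exact_mod_cast hs s hs' i
    rw [totalDegree_eq_zero_iff_eq_C] at hd
    have hc : f.coeff 0 ≠ 0 := by
      intro h0
      rw [h0, C_0] at hd
      exact hf.ne_zero hd
    apply hf.not_isUnit
    rw [hd]
    exact (isUnit_iff_ne_zero.2 hc).map C

theorem derivative_aeval {K R σ : Type*} [CommRing K] [CommRing R] [Algebra K R] [Fintype σ]
    (x : σ → Polynomial R) (f : MvPolynomial σ K) :
    Polynomial.derivative (aeval x f) =
      ∑ i, aeval x (pderiv i f) * Polynomial.derivative (x i) := by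
  classical
  induction f using MvPolynomial.induction_on with
  | C r => simp [Polynomial.algebraMap_apply]
  | add p q hp hq => simp [hp, hq, add_mul, Finset.sum_add_distrib]
  | mul_X p j hp =>
    rw [map_mul, aeval_X, Polynomial.derivative_mul, hp, Finset.sum_mul]
    simp only [pderiv_mul, map_add, map_mul, aeval_X, add_mul, Finset.sum_add_distrib]
    refine congrArg₂ (· + ·) (Finset.sum_congr rfl fun i _ => by ring) ?_
    · rw [Finset.sum_eq_single j]
      · simp
      · intro i _ hi
        simp [pderiv_X, hi.symm]
      · simp

/-- Viewed as a polynomial in the `τ` variables over the ring in the `σ` variables, the renamed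
polynomial is a constant. -/
theorem prime_rename_inl {L σ τ : Type*} [CommRing L] (f : MvPolynomial σ L) (hf : Prime f) :
    Prime (rename (Sum.inl : σ → σ ⊕ τ) f) := by
  let e : MvPolynomial (σ ⊕ τ) L ≃ₐ[L] MvPolynomial τ (MvPolynomial σ L) :=
    (renameEquiv L (Equiv.sumComm σ τ)).trans (sumAlgEquiv L τ σ)
  have he : ∀ g : MvPolynomial σ L, e (rename Sum.inl g) = C g := by
    intro g
    have : (e.toAlgHom.toRingHom.comp (rename (Sum.inl : σ → σ ⊕ τ)).toRingHom) =
        (C : MvPolynomial σ L →+* MvPolynomial τ (MvPolynomial σ L)) := by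
      apply ringHom_ext
      · intro r
        simp [e, sumAlgEquiv_C_inl]
      · intro i
        simp [e, sumAlgEquiv_X_inr]
    exact RingHom.congr_fun this g
  rw [← MulEquiv.prime_iff e, he]
  exact (prime_C_iff _).2 hf

theorem IsHomogeneous.eval_mul {L σ : Type*} [CommRing L] {g : MvPolynomial σ L} {d : ℕ}
    (hg : g.IsHomogeneous d) (r : L) (x : σ → L) :
    eval (fun i => r * x i) g = r ^ d * eval x g := by
  rw [eval_eq, eval_eq, Finset.mul_sum]
  refine Finset.sum_congr rfl fun s hs => ?_
  have hd : ∑ i ∈ s.support, s i = d := by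
    rw [← Finsupp.degree_apply]
    by_contra hne
    exact mem_support_iff.1 hs (hg.coeff_eq_zero hne)
  simp only [mul_pow]
  rw [Finset.prod_mul_distrib, Finset.prod_pow_eq_pow_sum, hd]
  ring

/-- Dehomogenizing with respect to the variable `0` does not kill a homogeneous polynomial. -/
theorem IsHomogeneous.exists_eval_cons_one_ne_zero {L : Type*} [Field L] [Infinite L] {m d : ℕ}
    {g : MvPolynomial (Fin (m + 1)) L} (hg : g.IsHomogeneous d) (hg0 : g ≠ 0) :
    ∃ w : Fin m → L, eval (Fin.cons 1 w : Fin (m + 1) → L) g ≠ 0 := by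
  -- The factor `X 0` supplies a point with nonzero first coordinate, which homogeneity allows to be
  -- scaled to `1`.
  have h0 : g * X 0 ≠ 0 := mul_ne_zero hg0 (X_ne_zero 0)
  obtain ⟨x, hx⟩ : ∃ x, eval x (g * X 0) ≠ 0 := by
    by_contra! h
    exact h0 (MvPolynomial.funext fun x => by rw [h x, map_zero])
  rw [map_mul, eval_X] at hx
  have hx0 := right_ne_zero_of_mul hx
  refine ⟨fun i => (x 0)⁻¹ * x i.succ, ?_⟩
  have : (Fin.cons 1 (fun i => (x 0)⁻¹ * x i.succ) : Fin (m + 1) → L) =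
      fun i => (x 0)⁻¹ * x i := by
    funext i
    refine Fin.cases ?_ (fun i => ?_) i
    · simp [hx0]
    · simp
  rw [this, hg.eval_mul]
  exact mul_ne_zero (pow_ne_zero _ (inv_ne_zero hx0)) (left_ne_zero_of_mul hx)

end MvPolynomial

/-! ### The generic line section. -/

namespace KaltofenPlane

section GenericLine

/-- The direction `(1, W₂, …, Wₙ)` of the generic line. -/
noncomputable def genericDirection (K : Type*) [CommRing K] (m : ℕ) :
    Fin (m + 1) → MvPolynomial (Fin (m + 1) ⊕ Fin m) K :=
  Fin.cons 1 fun i => MvPolynomial.X (Sum.inr i)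

/-- The restriction `f (V + X (1, W))` of `f` to the generic line. -/
noncomputable def genericLine {K : Type*} [CommRing K] {m : ℕ}
    (f : MvPolynomial (Fin (m + 1)) K) : Polynomial (MvPolynomial (Fin (m + 1) ⊕ Fin m) K) :=
  MvPolynomial.aeval (fun i => Polynomial.C (MvPolynomial.X (Sum.inl i)) +
    Polynomial.C (genericDirection K m i) * Polynomial.X) f

theorem map_genericDirection {K L : Type*} [CommRing K] [CommRing L] {m : ℕ} (φ : K →+* L)
    (i : Fin (m + 1)) :
    MvPolynomial.map φ (genericDirection K m i) = genericDirection L m i := by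
  refine Fin.cases ?_ (fun i => ?_) i <;> simp [genericDirection]

theorem map_genericLine {K L : Type*} [CommRing K] [CommRing L] {m : ℕ} (φ : K →+* L)
    (f : MvPolynomial (Fin (m + 1)) K) :
    (genericLine f).map (MvPolynomial.map φ) = genericLine (MvPolynomial.map φ f) := by
  rw [genericLine, genericLine, MvPolynomial.aeval_def, MvPolynomial.aeval_def,
    ← Polynomial.coe_mapRingHom, MvPolynomial.hom_eval₂, MvPolynomial.eval₂_map]
  congr 1
  · ext r : 1
    simp [Polynomial.algebraMap_apply, MvPolynomial.algebraMap_eq]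
  · funext i
    simp [map_genericDirection]

variable {L : Type*} [Field L] {m : ℕ}

/-- The shift `V ↦ V + ε X (1, W)`. -/
noncomputable def genericShift (L : Type*) [Field L] (m : ℕ) (ε : L) :
    Polynomial (MvPolynomial (Fin (m + 1) ⊕ Fin m) L) →+*
      Polynomial (MvPolynomial (Fin (m + 1) ⊕ Fin m) L) :=
  Polynomial.eval₂RingHom (MvPolynomial.eval₂Hom (Polynomial.C.comp MvPolynomial.C)
    (Sum.elim (fun i => Polynomial.C (MvPolynomial.X (Sum.inl i)) +
      Polynomial.C (MvPolynomial.C ε * genericDirection L m i) * Polynomial.X)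
      (fun j => Polynomial.C (MvPolynomial.X (Sum.inr j))))) Polynomial.X

theorem genericShift_direction (ε : L) (i : Fin (m + 1)) :
    genericShift L m ε (Polynomial.C (genericDirection L m i)) =
      Polynomial.C (genericDirection L m i) := by
  refine Fin.cases ?_ (fun i => ?_) i <;> simp [genericDirection, genericShift]

theorem genericShift_X (ε : L) : genericShift L m ε Polynomial.X = Polynomial.X := by
  simp [genericShift]

theorem genericShift_C_C (ε r : L) : genericShift L m ε (Polynomial.C (MvPolynomial.C r)) =
    Polynomial.C (MvPolynomial.C r) := by
  simp [genericShift]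

theorem genericShift_inr (ε : L) (j : Fin m) :
    genericShift L m ε (Polynomial.C (MvPolynomial.X (Sum.inr j))) =
      Polynomial.C (MvPolynomial.X (Sum.inr j)) := by
  simp [genericShift]

theorem genericShift_inl (ε : L) (i : Fin (m + 1)) :
    genericShift L m ε (Polynomial.C (MvPolynomial.X (Sum.inl i))) =
      Polynomial.C (MvPolynomial.X (Sum.inl i)) +
        Polynomial.C (MvPolynomial.C ε) * Polynomial.C (genericDirection L m i) * Polynomial.X := by
  simp [genericShift]

theorem genericShift_comp (ε ε' : L) (h : ε + ε' = 0) :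
    (genericShift L m ε).comp (genericShift L m ε') = RingHom.id _ := by
  apply Polynomial.ringHom_ext'
  · apply MvPolynomial.ringHom_ext
    · intro r
      simp [genericShift_C_C]
    · rintro (i | j)
      · simp only [RingHom.comp_apply, genericShift_inl, map_add, map_mul, genericShift_C_C,
          genericShift_direction, genericShift_X, RingHom.id_apply]
        have : (Polynomial.C (MvPolynomial.C ε) :
            Polynomial (MvPolynomial (Fin (m + 1) ⊕ Fin m) L)) =
            -Polynomial.C (MvPolynomial.C ε') := by
          rw [eq_neg_of_add_eq_zero_left h, map_neg, map_neg]
        rw [this]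
        ring
      · simp [genericShift_inr]
  · simp [genericShift_X]

/-- The shift `V ↦ V + X (1, W)` is an automorphism with inverse `V ↦ V - X (1, W)`; it carries
`f(V)`, prime in the larger ring, to the generic line section. -/
theorem prime_genericLine (f : MvPolynomial (Fin (m + 1)) L) (hf : Irreducible f) :
    Prime (genericLine f) := by
  let e := RingEquiv.ofRingHom (genericShift L m 1) (genericShift L m (-1))
    (genericShift_comp _ _ (by ring)) (genericShift_comp _ _ (by ring))
  have he : genericShift L m 1 (Polynomial.C (MvPolynomial.rename Sum.inl f)) = genericLine f := by
    have : ((genericShift L m 1).comp Polynomial.C).comp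
        (MvPolynomial.rename (R := L) (Sum.inl : Fin (m + 1) → Fin (m + 1) ⊕ Fin m)).toRingHom =
        (MvPolynomial.aeval (R := L) (fun i => Polynomial.C (MvPolynomial.X (Sum.inl i)) +
          Polynomial.C (genericDirection L m i) * Polynomial.X)).toRingHom := by
      apply MvPolynomial.ringHom_ext
      · intro r
        simp [genericShift_C_C, Polynomial.algebraMap_apply, MvPolynomial.algebraMap_eq]
      · intro i
        simp [genericShift_inl]
    exact RingHom.congr_fun this f
  have hprime : Prime (e (Polynomial.C (MvPolynomial.rename Sum.inl f))) :=
    (MulEquiv.prime_iff e).2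
      (Polynomial.prime_C_iff.2 (MvPolynomial.prime_rename_inl f hf.prime))
  rw [← he]
  exact hprime

/-- At `X = 0` the derivative is `∂₁ f + ∑ W_i ∂_i f`. Taking `W = 0` and then `W` a unit vector
isolates each partial derivative, and these cannot all vanish. -/
theorem derivative_genericLine_ne_zero [IsAlgClosed L] (f : MvPolynomial (Fin (m + 1)) L)
    (hf : Irreducible f) : Polynomial.derivative (genericLine f) ≠ 0 := by
  intro h
  have key : ∀ w : Fin m → L,
      ∑ i, MvPolynomial.pderiv i f * MvPolynomial.C ((Fin.cons 1 w : Fin (m + 1) → L) i) = 0 := by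
    intro w
    let φ : Polynomial (MvPolynomial (Fin (m + 1) ⊕ Fin m) L) →ₐ[L] MvPolynomial (Fin (m + 1)) L :=
      (MvPolynomial.aeval (Sum.elim MvPolynomial.X fun j => MvPolynomial.C (w j))).comp
        ((Polynomial.aeval (0 : MvPolynomial (Fin (m + 1) ⊕ Fin m) L)).restrictScalars L)
    have h1 := congrArg φ h
    rw [genericLine, MvPolynomial.derivative_aeval, map_sum, map_zero] at h1
    rw [← h1]
    refine Finset.sum_congr rfl fun i _ => ?_
    rw [map_mul, MvPolynomial.comp_aeval_apply]
    congr 1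
    · conv_lhs => rw [← MvPolynomial.aeval_X_left_apply (MvPolynomial.pderiv i f)]
      congr 2
      funext j
      simp [φ]
    · refine Fin.cases ?_ (fun i => ?_) i <;> simp [φ, genericDirection]
  have h0 : MvPolynomial.pderiv 0 f = 0 := by
    have := key 0
    rw [Fin.sum_univ_succ] at this
    simpa using this
  obtain ⟨i, hi⟩ := MvPolynomial.exists_pderiv_ne_zero f hf
  refine hi ?_
  clear hi
  refine Fin.cases h0 (fun i => ?_) i
  have := key (Pi.single i 1)
  rw [Fin.sum_univ_succ, h0, zero_mul, zero_add, Finset.sum_eq_single i] at this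
  · simpa using this
  · intro j _ hj
    simp [hj]
  · simp

/-- This coefficient is the top form of `f` at `(1, W)`, and a nonzero form survives
dehomogenization. -/
theorem coeff_genericLine_ne_zero [Infinite L] (f : MvPolynomial (Fin (m + 1)) L) (hf : f ≠ 0) :
    (genericLine f).coeff f.totalDegree ≠ 0 := by
  rw [genericLine, MvPolynomial.coeff_aeval_line _ _ _ _ le_rfl]
  obtain ⟨w, hw⟩ := (MvPolynomial.homogeneousComponent_isHomogeneous
    f.totalDegree f).exists_eval_cons_one_ne_zero
      (MvPolynomial.homogeneousComponent_totalDegree_ne_zero f hf)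
  intro h
  apply hw
  have h1 := congrArg (MvPolynomial.aeval (Sum.elim (0 : Fin (m + 1) → L) w)) h
  rw [map_zero, MvPolynomial.comp_aeval_apply] at h1
  rw [← h1, ← MvPolynomial.aeval_eq_eval]
  congr 2
  funext i
  refine Fin.cases ?_ (fun i => ?_) i <;> simp [genericDirection]

theorem natDegree_genericLine_le {K : Type*} [CommRing K] (f : MvPolynomial (Fin (m + 1)) K) :
    (genericLine f).natDegree ≤ f.totalDegree := by
  refine Polynomial.natDegree_aeval_le _ (fun i => ?_) f
  rw [add_comm (Polynomial.C _)]
  exact Polynomial.natDegree_linear_le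

theorem natDegree_genericLine [Infinite L] (f : MvPolynomial (Fin (m + 1)) L) (hf : f ≠ 0) :
    (genericLine f).natDegree = f.totalDegree :=
  le_antisymm (natDegree_genericLine_le f)
    (Polynomial.le_natDegree_of_ne_zero (coeff_genericLine_ne_zero f hf))

theorem totalDegree_coeff_genericLine_le {K : Type*} [Field K] (f : MvPolynomial (Fin (m + 1)) K)
    (k : ℕ) : ((genericLine f).coeff k).totalDegree ≤ f.totalDegree := by
  refine MvPolynomial.totalDegree_coeff_aeval_le _ (fun i k => ?_) f k
  have hdir : (genericDirection K m i).totalDegree ≤ 1 := by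
    refine Fin.cases ?_ (fun i => ?_) i <;> simp [genericDirection]
  rw [Polynomial.coeff_add, Polynomial.coeff_C, Polynomial.coeff_C_mul, Polynomial.coeff_X]
  refine (MvPolynomial.totalDegree_add _ _).trans (max_le ?_ ?_)
  · split_ifs <;> simp
  · split_ifs <;> simp [hdir]

/-- `F` is irreducible over the fraction field by Gauss's lemma, and `F'` is nonzero of smaller
degree, so the two are coprime. -/
theorem resultant_genericLine_ne_zero [IsAlgClosed L] (f : MvPolynomial (Fin (m + 1)) L)
    (hf : Irreducible f) :
    Polynomial.resultant (genericLine f) (Polynomial.derivative (genericLine f)) f.totalDegree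
      (f.totalDegree - 1) ≠ 0 := by
  set F := genericLine f with hF
  have hdeg : F.natDegree = f.totalDegree := natDegree_genericLine f hf.ne_zero
  have hder := derivative_genericLine_ne_zero f hf
  have hFirr : Irreducible F := (prime_genericLine f hf).irreducible
  have hpos : F.natDegree ≠ 0 := by
    intro h0
    apply hder
    rw [← hF, Polynomial.eq_C_of_natDegree_eq_zero h0, Polynomial.derivative_C]
  let Q := FractionRing (MvPolynomial (Fin (m + 1) ⊕ Fin m) L)
  have hinj := IsFractionRing.injective (MvPolynomial (Fin (m + 1) ⊕ Fin m) L) Q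
  have hprim := hFirr.isPrimitive hpos
  have hirr := (hprim.irreducible_iff_irreducible_map_fraction_map (K := Q)).1 hFirr
  have hcop : IsCoprime (F.map (algebraMap _ Q)) (F.derivative.map (algebraMap _ Q)) := by
    refine (EuclideanDomain.dvd_or_coprime _ _ hirr).resolve_left fun hdvd => ?_
    have h1 := hprim.dvd_of_fraction_map_dvd_fraction_map hdvd
    have h2 := Polynomial.natDegree_le_of_dvd h1 hder
    have h3 := Polynomial.natDegree_derivative_le F
    omega
  have hres := Polynomial.resultant_ne_zero _ _ hcop
  rw [Polynomial.natDegree_map_eq_of_injective hinj, Polynomial.natDegree_map_eq_of_injective hinj,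
    Polynomial.resultant_map_map] at hres
  have hres' : Polynomial.resultant F F.derivative F.natDegree F.derivative.natDegree ≠ 0 :=
    fun h => hres (by rw [h, map_zero])
  -- In positive characteristic `F'` may have degree below `δ - 1`; the excess `k` in the formal
  -- degree contributes only a power of the leading coefficient of `F`, up to sign.
  obtain ⟨k, hk⟩ := Nat.exists_eq_add_of_le (Polynomial.natDegree_derivative_le F)
  rw [← hdeg, hk, Polynomial.resultant_add_right_deg _ _ _ _ _ le_rfl]
  refine mul_ne_zero (pow_ne_zero _ ?_) hres'
  rw [Polynomial.coeff_natDegree, Ne, Polynomial.leadingCoeff_eq_zero]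
  exact hFirr.ne_zero

end GenericLine

end KaltofenPlane

/-! ### Primes under endomorphisms invertible away from a prime `y`. -/

namespace KaltofenPlane

section Saturation

variable {A : Type*} [CommRing A] (Θ : A →+* A) (y : A) (hy : Θ y = y)

theorem mem_of_add_mem_of_mem_right {A : Type*} [CommRing A] {S : Subring A} {a b : A}
    (h : a + b ∈ S) (hb : b ∈ S) : a ∈ S := by
  simpa using S.sub_mem h hb

/-- The elements that enter the range of `Θ` after multiplication by a power of `y`. -/
def saturatedRange : Subring A where
  carrier := {g | ∃ (N : ℕ) (g' : A), Θ g' = y ^ N * g}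
  one_mem' := ⟨0, 1, by simp⟩
  zero_mem' := ⟨0, 0, by simp⟩
  add_mem' := by
    rintro p q ⟨M, p', hp⟩ ⟨N, q', hq⟩
    refine ⟨M + N, y ^ N * p' + y ^ M * q', ?_⟩
    rw [map_add, map_mul, map_mul, map_pow, map_pow, hy, hp, hq]
    ring
  mul_mem' := by
    rintro p q ⟨M, p', hp⟩ ⟨N, q', hq⟩
    refine ⟨M + N, p' * q', ?_⟩
    rw [map_mul, hp, hq]
    ring
  neg_mem' := by
    rintro p ⟨M, p', hp⟩
    exact ⟨M, -p', by rw [map_neg, hp, mul_neg]⟩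

theorem map_mem_saturatedRange (g : A) : Θ g ∈ saturatedRange Θ y hy := ⟨0, g, by simp⟩

theorem mem_saturatedRange_of_mul_mem (g : A) (h : g * y ∈ saturatedRange Θ y hy) :
    g ∈ saturatedRange Θ y hy := by
  obtain ⟨N, g', hg'⟩ := h
  exact ⟨N + 1, g', by rw [hg', pow_succ, mul_assoc, mul_comm g]⟩

/-- An endomorphism that becomes an automorphism after inverting a fixed prime `y` maps primes to
primes or to multiples of `y`. -/
theorem prime_map_of_saturatedRange_eq_top [IsDomain A] (hΘ : Function.Injective Θ)
    (hyp : Prime y) (htop : saturatedRange Θ y hy = ⊤) (P : A) (hP : Prime P)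
    (hyP : ¬ y ∣ Θ P) (hunit : ¬ IsUnit (Θ P)) : Prime (Θ P) := by
  have hsat : ∀ g : A, ∃ (N : ℕ) (g' : A), Θ g' = y ^ N * g := by
    intro g
    have : g ∈ saturatedRange Θ y hy := by
      rw [htop]
      exact Subring.mem_top g
    exact this
  -- Since the prime `y` does not divide `Θ P`, the power of `y` divides the cofactor and can be
  -- cancelled.
  have hcancel : ∀ g g' N, Θ g' = y ^ N * g → P ∣ g' → Θ P ∣ g := by
    rintro g g' N hg ⟨u, rfl⟩
    rw [map_mul] at hg
    obtain ⟨w, hw⟩ := hyp.pow_dvd_of_dvd_mul_left N hyP (Dvd.intro _ hg.symm)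
    refine ⟨w, ?_⟩
    rw [hw, mul_left_comm] at hg
    exact (mul_left_cancel₀ (pow_ne_zero N hyp.ne_zero) hg).symm
  refine ⟨(map_ne_zero_iff Θ hΘ).2 hP.ne_zero, hunit, ?_⟩
  rintro g h ⟨u, hu⟩
  obtain ⟨M, g', hg'⟩ := hsat g
  obtain ⟨N, h', hh'⟩ := hsat h
  obtain ⟨k, u', hu'⟩ := hsat u
  have hprod : y ^ k * (g' * h') = P * (y ^ (M + N) * u') := by
    apply hΘ
    simp only [map_mul, map_pow, hy, hg', hh', hu']
    linear_combination y ^ (k + M + N) * hu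
  -- Otherwise `P` is associated to `y`, and `Θ y = y` gives `y ∣ Θ P`.
  have hPY : ¬ P ∣ y ^ k := by
    intro hd
    have h1 := (hP.associated_of_dvd hyp (hP.dvd_of_dvd_pow hd)).symm.dvd
    have h2 := map_dvd Θ h1
    rw [hy] at h2
    exact hyP h2
  rcases hP.dvd_or_dvd ((hP.dvd_or_dvd (Dvd.intro _ hprod.symm)).resolve_left hPY) with hd | hd
  · exact Or.inl (hcancel g g' M hg' hd)
  · exact Or.inr (hcancel h h' N hh' hd)

end Saturation

/-! ### Irreducibility of `χ`. -/

section Irreducibility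

variable {L : Type*} [Field L] {m : ℕ} (ν : Fin (m + 1) → L) (ω : Fin m → L)

/-- The substitution `X ↦ X + ν₁`, `Zᵢ ↦ ωᵢ X + Zᵢ Y + νᵢ`, which becomes invertible after inverting
`Y`. -/
noncomputable def planeHom : Polynomial (Polynomial (MvPolynomial (Fin m) L)) →+*
    Polynomial (Polynomial (MvPolynomial (Fin m) L)) :=
  Polynomial.eval₂RingHom (R := Polynomial (MvPolynomial (Fin m) L))
    (S := Polynomial (Polynomial (MvPolynomial (Fin m) L)))
    (Polynomial.eval₂RingHom (R := MvPolynomial (Fin m) L)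
      (S := Polynomial (Polynomial (MvPolynomial (Fin m) L)))
      (MvPolynomial.eval₂Hom (S₁ := Polynomial (Polynomial (MvPolynomial (Fin m) L)))
        ((Polynomial.C.comp Polynomial.C).comp MvPolynomial.C)
        (fun i => Polynomial.C (Polynomial.C (MvPolynomial.C (ω i))) * Polynomial.X +
          Polynomial.C (Polynomial.C (MvPolynomial.X i)) * Polynomial.C Polynomial.X +
          Polynomial.C (Polynomial.C (MvPolynomial.C (ν i.succ)))))
      (Polynomial.C Polynomial.X))
    (Polynomial.X + Polynomial.C (Polynomial.C (MvPolynomial.C (ν 0))))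

theorem planeHom_const (r : L) :
    planeHom ν ω (Polynomial.C (Polynomial.C (MvPolynomial.C r))) =
      Polynomial.C (Polynomial.C (MvPolynomial.C r)) := by
  simp [planeHom]

theorem planeHom_Z (i : Fin m) :
    planeHom ν ω (Polynomial.C (Polynomial.C (MvPolynomial.X i))) =
      Polynomial.C (Polynomial.C (MvPolynomial.C (ω i))) * Polynomial.X +
      Polynomial.C (Polynomial.C (MvPolynomial.X i)) * Polynomial.C Polynomial.X +
      Polynomial.C (Polynomial.C (MvPolynomial.C (ν i.succ))) := by
  simp [planeHom]

theorem planeHom_Y : planeHom ν ω (Polynomial.C Polynomial.X) = Polynomial.C Polynomial.X := by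
  simp [planeHom]

theorem planeHom_X : planeHom ν ω Polynomial.X =
    Polynomial.X + Polynomial.C (Polynomial.C (MvPolynomial.C (ν 0))) := by
  simp [planeHom]

/-- Solving the substitution for `Z_i` requires only division by `Y`, so a left inverse exists with
values in the fraction field. -/
theorem planeHom_injective : Function.Injective (planeHom ν ω) := by
  let Q := FractionRing (Polynomial (Polynomial (MvPolynomial (Fin m) L)))
  obtain ⟨ι, hι⟩ : ∃ ι : Polynomial (Polynomial (MvPolynomial (Fin m) L)) →+* Q,
      Function.Injective ι :=
    ⟨_, IsFractionRing.injective (Polynomial (Polynomial (MvPolynomial (Fin m) L))) Q⟩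
  let c : L →+* Q := (ι.comp Polynomial.C).comp
    ((Polynomial.C : MvPolynomial (Fin m) L →+* _).comp MvPolynomial.C)
  have hc : ∀ r, ι (Polynomial.C (Polynomial.C (MvPolynomial.C r))) = c r := fun r => rfl
  let x : Q := ι Polynomial.X
  let y : Q := ι (Polynomial.C Polynomial.X)
  let z : Fin m → Q := fun i => ι (Polynomial.C (Polynomial.C (MvPolynomial.X i)))
  have hy : y ≠ 0 := by
    rw [Ne, map_eq_zero_iff ι hι]
    simp
  let back : Polynomial (Polynomial (MvPolynomial (Fin m) L)) →+* Q :=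
    Polynomial.eval₂RingHom (Polynomial.eval₂RingHom (MvPolynomial.eval₂Hom c
      (fun i => (z i - c (ω i) * (x - c (ν 0)) - c (ν i.succ)) * y⁻¹)) y) (x - c (ν 0))
  have hback : back.comp (planeHom ν ω) = ι := by
    apply Polynomial.ringHom_ext'
    · apply Polynomial.ringHom_ext'
      · apply MvPolynomial.ringHom_ext
        · intro r
          simp only [RingHom.comp_apply, planeHom_const, hc]
          simp [back]
        · intro i
          simp only [RingHom.comp_apply, planeHom_Z]
          simp only [back, map_add, map_mul, Polynomial.coe_eval₂RingHom, Polynomial.eval₂_C,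
            Polynomial.eval₂_X, MvPolynomial.coe_eval₂Hom, MvPolynomial.eval₂_C,
            MvPolynomial.eval₂_X]
          rw [mul_assoc, inv_mul_cancel₀ hy]
          ring
      · simp only [RingHom.comp_apply, planeHom_Y]
        simp [back, y]
    · simp only [RingHom.comp_apply, planeHom_X]
      simp [back, x]
  intro p q hpq
  apply hι
  rw [← hback]
  simp only [RingHom.comp_apply, hpq]

theorem subring_eq_top_of_generators
    (S : Subring (Polynomial (Polynomial (MvPolynomial (Fin m) L))))
    (hconst : ∀ r : L, Polynomial.C (Polynomial.C (MvPolynomial.C r)) ∈ S)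
    (hZ : ∀ i, Polynomial.C (Polynomial.C (MvPolynomial.X i)) ∈ S)
    (hY : Polynomial.C Polynomial.X ∈ S) (hX : Polynomial.X ∈ S) : S = ⊤ := by
  have hB : ∀ b : MvPolynomial (Fin m) L, Polynomial.C (Polynomial.C b) ∈ S := by
    intro b
    induction b using MvPolynomial.induction_on with
    | C r => exact hconst r
    | add p q hp hq => simpa using S.add_mem hp hq
    | mul_X p i hp => simpa using S.mul_mem hp (hZ i)
  have hBY : ∀ b : Polynomial (MvPolynomial (Fin m) L), Polynomial.C b ∈ S := by
    intro b
    induction b using Polynomial.induction_on' with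
    | add p q hp hq => simpa using S.add_mem hp hq
    | monomial n a =>
      rw [← Polynomial.C_mul_X_pow_eq_monomial]
      simpa using S.mul_mem (hB a) (S.pow_mem hY n)
  rw [eq_top_iff]
  intro g _
  induction g using Polynomial.induction_on' with
  | add p q hp hq => exact S.add_mem (hp trivial) (hq trivial)
  | monomial n a =>
    rw [← Polynomial.C_mul_X_pow_eq_monomial]
    exact S.mul_mem (hBY a) (S.pow_mem hX n)

/-- Constants, `Y` and, after a translation, `X` are in the range; so is `Z_i Y` after subtracting
`ω_i X + ν_i`, and saturation removes the `Y`. -/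
theorem saturatedRange_planeHom :
    saturatedRange (A := Polynomial (Polynomial (MvPolynomial (Fin m) L)))
      (planeHom ν ω) (Polynomial.C Polynomial.X) (planeHom_Y ν ω) = ⊤ := by
  have hrange := map_mem_saturatedRange (A := Polynomial (Polynomial (MvPolynomial (Fin m) L)))
    (planeHom ν ω) (Polynomial.C Polynomial.X) (planeHom_Y ν ω)
  have hcancel := mem_saturatedRange_of_mul_mem
    (A := Polynomial (Polynomial (MvPolynomial (Fin m) L)))
    (planeHom ν ω) (Polynomial.C Polynomial.X) (planeHom_Y ν ω)
  revert hrange hcancel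
  generalize saturatedRange (A := Polynomial (Polynomial (MvPolynomial (Fin m) L)))
    (planeHom ν ω) (Polynomial.C Polynomial.X) (planeHom_Y ν ω) = S
  intro hrange hcancel
  have hconst : ∀ r : L, Polynomial.C (Polynomial.C (MvPolynomial.C r)) ∈ S := fun r => by
    have := hrange (Polynomial.C (Polynomial.C (MvPolynomial.C r)))
    rwa [planeHom_const] at this
  have hX : Polynomial.X ∈ S := by
    have h1 := hrange Polynomial.X
    rw [planeHom_X] at h1
    exact mem_of_add_mem_of_mem_right h1 (hconst (ν 0))
  have hY : Polynomial.C Polynomial.X ∈ S := by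
    have := hrange (Polynomial.C Polynomial.X)
    rwa [planeHom_Y] at this
  refine subring_eq_top_of_generators S hconst (fun i => hcancel _ ?_) hY hX
  have h1 := hrange (Polynomial.C (Polynomial.C (MvPolynomial.X i)))
  rw [planeHom_Z] at h1
  have h2 := mem_of_add_mem_of_mem_right h1 (hconst (ν i.succ))
  rw [add_comm] at h2
  exact mem_of_add_mem_of_mem_right h2 (S.mul_mem (hconst (ω i)) hX)

/-- `f (X, Z)`, viewed as a polynomial in `X`, `Y`, `Z`. -/
noncomputable def planeEmbed (L : Type*) [Field L] (m : ℕ) : MvPolynomial (Fin (m + 1)) L →+*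
    Polynomial (Polynomial (MvPolynomial (Fin m) L)) :=
  (Polynomial.mapRingHom Polynomial.C).comp (MvPolynomial.finSuccEquiv L m).toAlgHom.toRingHom

/-- `Y` does not occur, so swapping the order of the variables turns the polynomial into a constant
over `L[Z][X]`. -/
theorem prime_planeEmbed (f : MvPolynomial (Fin (m + 1)) L) (hf : Irreducible f) :
    Prime (planeEmbed L m f) := by
  have h1 : Prime (MvPolynomial.finSuccEquiv L m f) :=
    (MulEquiv.prime_iff (MvPolynomial.finSuccEquiv L m)).2 hf.prime
  have h2 := (MulEquiv.prime_iff (Polynomial.Bivariate.swap (R := MvPolynomial (Fin m) L))).2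
    (Polynomial.prime_C_iff.2 h1)
  rw [Polynomial.Bivariate.swap_C] at h2
  exact h2

theorem chi_eq_planeHom {K : Type*} [Field K] [Algebra K L] (f : MvPolynomial (Fin (m + 1)) K) :
    chi f ν ω = planeHom ν ω (planeEmbed L m (MvPolynomial.map (algebraMap K L) f)) := by
  rw [chi, planeSubst_eq_aeval]
  have : (MvPolynomial.aeval (R := L) (Fin.cons (Polynomial.X + algebraMap L _ (ν 0))
      (fun i : Fin m => algebraMap L _ (ω i) * Polynomial.X +
        Polynomial.C (Polynomial.C (MvPolynomial.X i)) * Polynomial.C Polynomial.X +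
        algebraMap L _ (ν i.succ)) :
        Fin (m + 1) → Polynomial (Polynomial (MvPolynomial (Fin m) L)))).toRingHom =
      (planeHom ν ω).comp (planeEmbed L m) := by
    apply MvPolynomial.ringHom_ext
    · intro r
      have : planeEmbed L m (MvPolynomial.C r) = Polynomial.C (Polynomial.C (MvPolynomial.C r)) := by
        change (MvPolynomial.finSuccEquiv L m (MvPolynomial.C r)).map Polynomial.C = _
        rw [← MvPolynomial.algebraMap_eq, AlgEquiv.commutes]
        simp [Polynomial.algebraMap_apply]
      rw [RingHom.comp_apply, this, planeHom_const]
      simp [Polynomial.algebraMap_apply, MvPolynomial.algebraMap_eq]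
    · intro i
      refine Fin.cases ?_ (fun i => ?_) i
      · have : planeEmbed L m (MvPolynomial.X 0) = Polynomial.X := by
          change (MvPolynomial.finSuccEquiv L m (MvPolynomial.X 0)).map Polynomial.C = _
          rw [MvPolynomial.finSuccEquiv_X_zero, Polynomial.map_X]
        rw [RingHom.comp_apply, this, planeHom_X]
        simp [Polynomial.algebraMap_apply, MvPolynomial.algebraMap_eq]
      · have : planeEmbed L m (MvPolynomial.X i.succ) =
            Polynomial.C (Polynomial.C (MvPolynomial.X i)) := by
          change (MvPolynomial.finSuccEquiv L m (MvPolynomial.X i.succ)).map Polynomial.C = _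
          rw [MvPolynomial.finSuccEquiv_X_succ, Polynomial.map_C]
        rw [RingHom.comp_apply, this, planeHom_Z]
        simp [Polynomial.algebraMap_apply, MvPolynomial.algebraMap_eq]
  exact RingHom.congr_fun this _

/-- If the leading coefficient of `χ` is a nonzero constant, then `χ` inherits irreducibility
from `f`. -/
theorem irreducible_chi {K : Type*} [Field K] [Algebra K L] (f : MvPolynomial (Fin (m + 1)) K)
    (hf : Irreducible (MvPolynomial.map (algebraMap K L) f)) (c : L) (hc : c ≠ 0)
    (hlc : (chi f ν ω).leadingCoeff = Polynomial.C (MvPolynomial.C c))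
    (hdeg : (chi f ν ω).natDegree ≠ 0) : Irreducible (chi f ν ω) := by
  set P := planeEmbed L m (MvPolynomial.map (algebraMap K L) f) with hP
  have hPp : Prime P := prime_planeEmbed _ hf
  have hchi : chi f ν ω = planeHom ν ω P := chi_eq_planeHom ν ω f
  have hY : Prime (Polynomial.C Polynomial.X :
      Polynomial (Polynomial (MvPolynomial (Fin m) L))) :=
    Polynomial.prime_C_iff.2 Polynomial.prime_X
  have hYchi : ¬ Polynomial.C Polynomial.X ∣ chi f ν ω := by
    rw [Polynomial.C_dvd_iff_dvd_coeff]
    intro h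
    have h1 := h (chi f ν ω).natDegree
    rw [Polynomial.coeff_natDegree, hlc, Polynomial.X_dvd_iff, Polynomial.coeff_C_zero] at h1
    exact hc (by simpa using h1)
  rw [hchi] at hYchi hdeg ⊢
  exact (prime_map_of_saturatedRange_eq_top _ _ (planeHom_Y ν ω) (planeHom_injective ν ω) hY
    (saturatedRange_planeHom ν ω) P hPp hYchi
    fun hu => hdeg (Polynomial.natDegree_eq_zero_of_isUnit hu)).irreducible

end Irreducibility

/-! ### The polynomial `Υ`: part (a). -/

section GenericPosition

variable {K L : Type*} [Field K] [Field L] [Algebra K L] {m : ℕ}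
  (f : MvPolynomial (Fin (m + 1)) K) (ν : Fin (m + 1) → L) (ω : Fin m → L)

theorem chiLine_eq_map_genericLine :
    chiLine f ν ω = (genericLine f).map
      (MvPolynomial.aeval (R := K) (Sum.elim ν ω)).toRingHom := by
  rw [chiLine, planeSubst_eq_aeval, MvPolynomial.aeval_def, MvPolynomial.eval₂_map, genericLine,
    MvPolynomial.aeval_def, ← Polynomial.coe_mapRingHom, MvPolynomial.hom_eval₂]
  congr 1
  · ext r : 1
    simp [Polynomial.algebraMap_apply, MvPolynomial.algebraMap_eq]
  · funext i
    refine Fin.cases ?_ (fun i => ?_) i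
    · simp [genericDirection, add_comm]
    · simp [genericDirection, add_comm]

/-- Both coefficients are the top form of `f` at the direction `(1, ω)` of `X`, which involves
neither `Y` nor `Z`. -/
theorem coeff_chi_totalDegree :
    (chi f ν ω).coeff f.totalDegree =
      Polynomial.C (MvPolynomial.C ((chiLine f ν ω).coeff f.totalDegree)) := by
  have hd := MvPolynomial.totalDegree_map_eq_of_injective (algebraMap K L) (algebraMap K L).injective f
  set g := MvPolynomial.map (algebraMap K L) f with hg
  have h1 : chiLine f ν ω = MvPolynomial.aeval (fun i => Polynomial.C (ν i) +
      Polynomial.C ((Fin.cons 1 ω : Fin (m + 1) → L) i) * Polynomial.X) g := by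
    rw [chiLine, planeSubst_eq_aeval]
    congr 2
    funext i
    refine Fin.cases ?_ (fun i => ?_) i
    · simp [add_comm]
    · simp [add_comm]
  have h2 : chi f ν ω = MvPolynomial.aeval (fun i => Polynomial.C
        ((Fin.cons (algebraMap L _ (ν 0)) (fun i : Fin m =>
          Polynomial.C (MvPolynomial.X i) * Polynomial.X + algebraMap L _ (ν i.succ)) :
          Fin (m + 1) → Polynomial (MvPolynomial (Fin m) L)) i) +
      Polynomial.C (algebraMap L (Polynomial (MvPolynomial (Fin m) L))
        ((Fin.cons 1 ω : Fin (m + 1) → L) i)) * Polynomial.X) g := by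
    rw [chi, planeSubst_eq_aeval]
    congr 2
    funext i
    refine Fin.cases ?_ (fun i => ?_) i
    · simp [Polynomial.algebraMap_apply, add_comm]
    · simp [Polynomial.algebraMap_apply]
      ring
  rw [h1, h2, MvPolynomial.coeff_aeval_line _ _ _ _ hd.le, MvPolynomial.coeff_aeval_line _ _ _ _ hd.le]
  rw [← Function.comp_def (algebraMap L (Polynomial (MvPolynomial (Fin m) L)))
    (Fin.cons 1 ω : Fin (m + 1) → L), MvPolynomial.aeval_algebraMap_apply,
    Polynomial.algebraMap_apply, MvPolynomial.algebraMap_eq]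

/-- The polynomial `Υ`: leading coefficient times resultant of the generic line section and its
derivative. -/
noncomputable def genericityPoly : MvPolynomial (Fin (m + 1) ⊕ Fin m) K :=
  (genericLine f).coeff f.totalDegree *
    Polynomial.resultant (genericLine f) (Polynomial.derivative (genericLine f)) f.totalDegree
      (f.totalDegree - 1)

/-- All coefficients of the line section and its derivative have degree at most `δ`, which gives `δ
+ δ·δ + (δ - 1)·δ = 2δ²`. -/
theorem totalDegree_genericityPoly_le (hf : 0 < f.totalDegree) :
    (genericityPoly f).totalDegree ≤ 2 * f.totalDegree ^ 2 := by
  refine (MvPolynomial.totalDegree_mul _ _).trans ?_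
  have h1 := totalDegree_coeff_genericLine_le f f.totalDegree
  have h2 := MvPolynomial.totalDegree_resultant_le (genericLine f)
    (Polynomial.derivative (genericLine f)) f.totalDegree (f.totalDegree - 1) f.totalDegree
    f.totalDegree (totalDegree_coeff_genericLine_le f) (fun k => by
      rw [Polynomial.coeff_derivative]
      refine (MvPolynomial.totalDegree_mul _ _).trans ?_
      have : (((k : MvPolynomial (Fin (m + 1) ⊕ Fin m) K) + 1)).totalDegree = 0 := by
        have := MvPolynomial.totalDegree_C (σ := Fin (m + 1) ⊕ Fin m) ((k : K) + 1)
        simpa using this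
      rw [this, add_zero]
      exact totalDegree_coeff_genericLine_le f _)
  refine (add_le_add h1 h2).trans (le_of_eq ?_)
  obtain ⟨d, hd⟩ : ∃ d, f.totalDegree = d + 1 := ⟨f.totalDegree - 1, by omega⟩
  rw [hd, Nat.add_sub_cancel]
  ring

theorem genericityPoly_ne_zero [IsAlgClosed L]
    (hf : Irreducible (MvPolynomial.map (algebraMap K L) f)) : genericityPoly f ≠ 0 := by
  have hd := MvPolynomial.totalDegree_map_eq_of_injective (algebraMap K L) (algebraMap K L).injective f
  intro h
  have h1 := congrArg (MvPolynomial.map (algebraMap K L)) h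
  rw [genericityPoly, map_mul, map_zero, ← Polynomial.resultant_map_map,
    ← Polynomial.derivative_map, ← Polynomial.coeff_map, map_genericLine, ← hd] at h1
  exact mul_ne_zero (coeff_genericLine_ne_zero _ hf.ne_zero) (resultant_genericLine_ne_zero _ hf) h1

/-- The first factor of `Υ` controls the leading coefficient, and with it irreducibility; the second
is the resultant of `χ(X, 0)` and its derivative, hence controls the discriminant. -/
theorem isGenericPosition_of_aeval_ne_zero
    (hf : Irreducible (MvPolynomial.map (algebraMap K L) f)) (hpos : 0 < f.totalDegree)
    (h : MvPolynomial.aeval (Sum.elim ν ω) (genericityPoly f) ≠ 0) : IsGenericPosition f ν ω := by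
  rw [genericityPoly, map_mul] at h
  have hc : (chiLine f ν ω).coeff f.totalDegree ≠ 0 := by
    rw [chiLine_eq_map_genericLine, Polynomial.coeff_map]
    exact left_ne_zero_of_mul h
  have hres : Polynomial.resultant (chiLine f ν ω) (Polynomial.derivative (chiLine f ν ω))
      f.totalDegree (f.totalDegree - 1) ≠ 0 := by
    rw [chiLine_eq_map_genericLine, Polynomial.derivative_map, Polynomial.resultant_map_map]
    exact right_ne_zero_of_mul h
  have hcchi : (chi f ν ω).coeff f.totalDegree ≠ 0 := by
    rw [coeff_chi_totalDegree]
    simpa using hc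
  have hdeg : (chi f ν ω).natDegree = f.totalDegree :=
    le_antisymm (natDegree_chi_le f ν ω) (Polynomial.le_natDegree_of_ne_zero hcchi)
  have hlc : (chi f ν ω).leadingCoeff =
      Polynomial.C (MvPolynomial.C ((chiLine f ν ω).coeff f.totalDegree)) := by
    rw [Polynomial.leadingCoeff, hdeg, coeff_chi_totalDegree]
  refine ⟨⟨_, hc, hlc⟩, ?_, irreducible_chi ν ω f hf _ hc hlc (by omega)⟩
  have hline : (chiAtZero f ν ω).natDegree = f.totalDegree := by
    rw [chiAtZero, Polynomial.natDegree_map_of_leadingCoeff_ne_zero, hdeg]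
    rw [hlc]
    simpa using hc
  intro hd
  have h1 := Polynomial.resultant_deriv (f := chiAtZero f ν ω)
    (by rw [← Polynomial.natDegree_pos_iff_degree_pos, hline]; exact hpos)
  rw [hd, mul_zero, hline, chiAtZero_eq_map_chiLine, Polynomial.derivative_map,
    Polynomial.resultant_map_map] at h1
  exact hres (MvPolynomial.C_injective (Fin m) L (by rw [h1, map_zero]))

end GenericPosition

end KaltofenPlane

/-! ### The main theorem. -/

theorem mainTheorem7 {K L : Type*} [Field K] [Field L] [Algebra K L] [IsAlgClosure K L] {m : ℕ}
    (f : MvPolynomial (Fin (m + 1)) K)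
    (hf : Irreducible (MvPolynomial.map (algebraMap K L) f))
    (δ : ℕ) (hδ : f.totalDegree = δ) :
    (∃ Υ : MvPolynomial (Fin (m + 1) ⊕ Fin m) K, Υ ≠ 0 ∧ Υ.totalDegree ≤ 2 * δ ^ 2 ∧
      ∀ (ν : Fin (m + 1) → L) (ω : Fin m → L), MvPolynomial.aeval (Sum.elim ν ω) Υ ≠ 0 →
        KaltofenPlane.IsGenericPosition f ν ω) ∧
    (∀ (ν : Fin (m + 1) → L) (ω : Fin m → L), KaltofenPlane.IsGenericPosition f ν ω →
      ∀ D : ℕ, 1 ≤ D → D + 1 ≤ δ →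
        ∃ Ψ : MvPolynomial (Fin m) L, Ψ ≠ 0 ∧
          (Ψ.totalDegree : ℚ) ≤ (D : ℚ) * δ ^ 2 * (D + 1) * (D + 2)
            - ((D : ℚ) ^ 2 + 3 * D) * ((D : ℚ) ^ 2 + 3 * D + 2) * δ / 8 ∧
          ∀ η : Fin m → L, MvPolynomial.eval η Ψ ≠ 0 →
            ∀ g : MvPolynomial (Fin 2) L, Irreducible g → g.totalDegree ≤ D →
              ¬ g ∣ KaltofenPlane.chiAt f ν ω η) := by
  subst hδ
  have : IsAlgClosed L := IsAlgClosure.isAlgClosed K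
  have hd := MvPolynomial.totalDegree_map_eq_of_injective (algebraMap K L) (algebraMap K L).injective f
  have hpos : 0 < f.totalDegree := by
    rw [← hd, Nat.pos_iff_ne_zero]
    intro h0
    rw [MvPolynomial.totalDegree_eq_zero_iff_eq_C] at h0
    apply hf.not_isUnit
    rw [h0]
    refine (isUnit_iff_ne_zero.2 fun h1 => hf.ne_zero ?_).map MvPolynomial.C
    rw [h0, h1, map_zero]
  have hf0 : f ≠ 0 := by
    rintro rfl
    simp at hpos
  refine ⟨⟨KaltofenPlane.genericityPoly f, KaltofenPlane.genericityPoly_ne_zero (L := L) f hf,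
    KaltofenPlane.totalDegree_genericityPoly_le f hpos, fun ν ω h =>
      KaltofenPlane.isGenericPosition_of_aeval_ne_zero f ν ω hf hpos h⟩, ?_⟩
  intro ν ω h D hD1 hD
  obtain ⟨Ψ, hΨ, hdeg, hΨη⟩ := h.exists_factor_bound hf0 (D := D) (by omega)
  exact ⟨Ψ, hΨ, KaltofenPlane.cast_degree_bound (card_bivariateIndex D) hD hdeg hD1, hΨη⟩
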